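/- Let $A$ be a complex Banach algebra (possibly non-unital, with $\|ab\|\le\|a\|\|b\|$) with a bounded (conjugate-linear, anti-multiplicative) involution, let $G$ be a locally compact Hausdorff group with left Haar measure $ds$ and modular function $\Delta$ (normalised by $\Delta(r)\int_G f(sr)\,ds=\int_G f(s)\,ds$), and let $\alpha$ be a strongly continuous action of $G$ on $A$ by bounded involutive automorphisms. Assume that for each $\varepsilon>0$ the algebra $A$ has a $(1+\varepsilon)$-bounded approximate left identity, i.e. a net $(u_i)$ in $A$ with $\|u_i\|\le 1+\varepsilon$ and $u_ia\to a$ for all $a\in A$. Let $\mathcal H$ be a class of complex Hilbert spaces, and let $\mathcal R$ consist of all pairs $(\pi,U)$ where, for some $H\in\mathcal H$, $\pi:A\to B(H)$ is a contractive involutive homomorphism that is non-degenerate (the span of $\{\pi(a)x : a\in A,\,x\in H\}$ is dense in $H$), $U$ is a strongly continuous unitary representation of $G$ on $H$, and $\pi(\alpha_s(a))=U_s\pi(a)U_s^{-1}$ for all $a\in A$, $s\in G$. Assume that $\mathcal R$ is non-empty. Equip the space $C_c(G,A)$ of compactly supported continuous functions with the product $[f*g](s)=\int_G f(r)\,\alpha_r(g(r^{-1}s))\,dr$,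 the involution $f^*(s)=\Delta(s^{-1})\,\alpha_s(f(s^{-1})^*)$ and the seminorm $\sigma^{\mathcal R}(f)=\sup_{(\pi,U)\in\mathcal R}\|(\pi\rtimes U)(f)\|$, where $(\pi\rtimes U)(f)x=\int_G\pi(f(s))U_sx\,ds$. Let $(A\rtimes_\alpha G)^{\mathcal R}$ be the completion of $C_c(G,A)/\ker\sigma^{\mathcal R}$ in the norm induced by $\sigma^{\mathcal R}$, with the induced product and involution, let $q^{\mathcal R}:C_c(G,A)\to(A\rtimes_\alpha G)^{\mathcal R}$ be the canonical map, and for $(\pi,U)\in\mathcal R$ on $H$ let $(\pi\rtimes U)^{\mathcal R}:(A\rtimes_\alpha G)^{\mathcal R}\to B(H)$ be the continuous homomorphism determined by $(\pi\rtimes U)^{\mathcal R}(q^{\mathcal R}(f))=(\pi\rtimes U)(f)$. Then $(A\rtimes_\alpha G)^{\mathcal R}$ is a $C^*$-algebra, and $(\pi,U)\mapsto(\pi\rtimes U)^{\mathcal R}$ is a bijection between $\mathcal R$ and the non-degenerate involutive representations of $(A\rtimes_\alpha G)^{\mathcal R}$ in spaces from $\mathcal H$. This map preserves the set of closed invariant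 subspaces: a closed subspace is invariant under all $\pi(a)$ and all $U_s$ if and only if it is invariant under all $(\pi\rtimes U)^{\mathcal R}(c)$, $c \in (A\rtimes_\alpha G)^{\mathcal R}$. It also preserves the bounded intertwining operators between any two elements $(\pi,U)$ (on $H$) and $(\pi',U')$ (on $H'$) of $\mathcal R$: a bounded operator $\Phi:H\to H'$ satisfies $\pi'(a)\Phi=\Phi\pi(a)$ and $U'_s\Phi=\Phi U_s$ for all $a\in A$, $s\in G$ if and only if $(\pi'\rtimes U')^{\mathcal R}(c)\Phi=\Phi(\pi\rtimes U)^{\mathcal R}(c)$ for all $c\in(A\rtimes_\alpha G)^{\mathcal R}$. -/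

import Mathlib

open MeasureTheory Filter Topology
open scoped NNReal CompactlySupported Pointwise

universe u w v


noncomputable section

namespace BanachCrossed

section Haar

variable {G : Type w} [Group G] [TopologicalSpace G] [IsTopologicalGroup G]
  [LocallyCompactSpace G]

/-- The modular function `Δ`, normalised by `Δ(r) ∫ f(sr) ds = ∫ f(s) ds` for left Haar
measure; Mathlib's `modularCharacter` is normalised the other way round. -/
def modularFn (s : G) : ℝ := ((Measure.modularCharacter (s⁻¹) : ℝ≥0) : ℝ)

lemma modularFn_mul (s t : G) : modularFn (s * t) = modularFn s * modularFn t := by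
  simp [modularFn, mul_comm]

lemma modularFn_one : modularFn (1 : G) = 1 := by simp [modularFn]

lemma modularFn_inv_mul (s : G) : modularFn s⁻¹ * modularFn s = 1 := by
  rw [← modularFn_mul, inv_mul_cancel, modularFn_one]

variable [MeasurableSpace G] [BorelSpace G] (μ : Measure G) [μ.IsHaarMeasure]
variable {E : Type*} [NormedAddCommGroup E] [NormedSpace ℝ E] [CompleteSpace E]

lemma modularFn_mul_integral (f : G → ℝ) (hf : Continuous f) (hc : HasCompactSupport f)
    (r : G) : modularFn r * ∫ s, f (s * r) ∂μ = ∫ s, f s ∂μ := by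
  have h := Measure.integral_isMulLeftInvariant_eq_smul_of_hasCompactSupport
    (μ.map (· * r)) μ hf hc
  rw [integral_map (AEMeasurable.mul_const aemeasurable_id' _)
    hf.aestronglyMeasurable,
    ← Measure.modularCharacterFun_eq_haarScalarFactor μ r, integral_smul_nnreal_measure] at h
  have h2 : (Measure.modularCharacterFun r : ℝ) = modularFn r⁻¹ := by
    rw [modularFn, inv_inv]; rfl
  rw [h, NNReal.smul_def, h2, smul_eq_mul, ← mul_assoc, mul_comm (modularFn r),
    modularFn_inv_mul, one_mul]

lemma continuous_modularFn [T2Space G] : Continuous (modularFn : G → ℝ) := by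
  borelize G
  let ν : Measure G := Measure.haar
  obtain ⟨⟨f, f_cont⟩, f_comp, f_nonneg, f_one⟩ :
    ∃ f : C(G, ℝ), HasCompactSupport f ∧ 0 ≤ f ∧ f 1 ≠ 0 := exists_continuous_nonneg_pos 1
  have hpos : 0 < ∫ x, f x ∂ν :=
    f_cont.integral_pos_of_hasCompactSupport_nonneg_nonzero f_comp f_nonneg f_one
  have key : ∀ r : G, modularFn r = (∫ s, f (s * r⁻¹) ∂ν) / ∫ s, f s ∂ν := by
    intro r
    rw [eq_div_iff hpos.ne', ← modularFn_mul_integral ν f f_cont f_comp r⁻¹, ← mul_assoc,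
      mul_comm (modularFn r), modularFn_inv_mul, one_mul]
  have hcont : Continuous fun r : G => ∫ s, f (s * r⁻¹) ∂ν := by
    rw [continuous_iff_continuousAt]
    intro r₀
    obtain ⟨K, hK, hKn⟩ := exists_compact_mem_nhds r₀
    have : ContinuousOn (fun r : G => ∫ s, f (s * r⁻¹) ∂ν) K := by
      refine continuousOn_integral_of_compact_support (k := tsupport f * K)
        (f_comp.isCompact.mul hK) ?_ ?_
      · exact (f_cont.comp (continuous_snd.mul continuous_fst.inv)).continuousOn
      · intro p x hp hx
        contrapose! hx
        exact ⟨x * p⁻¹, subset_tsupport f hx, p, hp, by simp⟩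
    exact this.continuousAt hKn
  simp_rw [funext key]
  exact hcont.div_const _

lemma integral_modularFn_inv [T2Space G] (φ : G → E) (hφ : Continuous φ)
    (hc : HasCompactSupport φ) :
    ∫ s, modularFn s⁻¹ • φ s⁻¹ ∂μ = ∫ s, φ s ∂μ := by
  obtain ⟨⟨f, f_cont⟩, f_comp, f_nonneg, f_one⟩ :
    ∃ f : C(G, ℝ), HasCompactSupport f ∧ 0 ≤ f ∧ f 1 ≠ 0 := exists_continuous_nonneg_pos 1
  simp only [ContinuousMap.coe_mk] at f_comp f_one
  have hpos : 0 < ∫ x, f x ∂μ :=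
    f_cont.integral_pos_of_hasCompactSupport_nonneg_nonzero f_comp f_nonneg f_one
  have h1 : ∀ t : G, ∫ s, f (s * t) • φ t⁻¹ ∂μ =
      (∫ s, f s ∂μ) • (modularFn t⁻¹ • φ t⁻¹) := by
    intro t
    rw [integral_smul_const, smul_smul, ← modularFn_mul_integral μ f f_cont f_comp t]
    congr 1
    rw [mul_comm (modularFn t), mul_assoc, mul_comm (modularFn t), modularFn_inv_mul, mul_one]
  have h2 : ∫ t, ∫ s, f (s * t) • φ t⁻¹ ∂μ ∂μ = ∫ s, ∫ t, f (s * t) • φ t⁻¹ ∂μ ∂μ := by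
    refine integral_integral_swap_of_hasCompactSupport (f := fun t s => f (s * t) • φ t⁻¹) ?_ ?_
    · exact (f_cont.comp (continuous_snd.mul continuous_fst)).smul
        (hφ.comp continuous_fst.inv)
    · refine HasCompactSupport.intro
        ((hc.isCompact.inv).prod (f_comp.isCompact.mul hc.isCompact)) ?_
      rintro ⟨t, s⟩ hts
      contrapose! hts
      simp only [Function.uncurry_apply_pair, ne_eq, smul_eq_zero, not_or] at hts
      refine ⟨?_, s * t, subset_tsupport f hts.1, t⁻¹, subset_tsupport φ hts.2, by simp⟩
      exact Set.mem_inv.2 (subset_tsupport φ hts.2)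
  have h3 : ∀ s : G, ∫ t, f (s * t) • φ t⁻¹ ∂μ = ∫ t, f t • φ (t⁻¹ * s) ∂μ := by
    intro s
    rw [← integral_mul_left_eq_self (fun t => f t • φ (t⁻¹ * s)) s]
    simp
  have h4 : ∫ s, ∫ t, f t • φ (t⁻¹ * s) ∂μ ∂μ = ∫ t, ∫ s, f t • φ (t⁻¹ * s) ∂μ ∂μ := by
    refine integral_integral_swap_of_hasCompactSupport (f := fun s t => f t • φ (t⁻¹ * s)) ?_ ?_
    · exact (f_cont.comp continuous_snd).smul (hφ.comp (continuous_snd.inv.mul continuous_fst))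
    · refine HasCompactSupport.intro
        ((f_comp.isCompact.mul hc.isCompact).prod f_comp.isCompact) ?_
      rintro ⟨s, t⟩ hts
      contrapose! hts
      simp only [Function.uncurry_apply_pair, ne_eq, smul_eq_zero, not_or] at hts
      exact ⟨⟨t, subset_tsupport f hts.1, t⁻¹ * s, subset_tsupport φ hts.2, by simp⟩,
        subset_tsupport f hts.1⟩
  have h5 : ∀ t : G, ∫ s, f t • φ (t⁻¹ * s) ∂μ = f t • ∫ s, φ s ∂μ := by
    intro t
    rw [integral_smul, integral_mul_left_eq_self]
  simp_rw [h1, h3] at h2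
  rw [integral_smul, h4] at h2
  simp_rw [h5] at h2
  rw [integral_smul_const] at h2
  exact smul_right_injective E hpos.ne' h2

end Haar

/-- An involutive Banach algebra dynamical system `(A, G, α)`: a strongly continuous action of
`G` on `A` by bounded involutive automorphisms. -/
structure InvolutiveSystem (A : Type u) (G : Type w) [NonUnitalNormedRing A] [NormedSpace ℂ A]
    [StarRing A] [Group G] [TopologicalSpace G] where
  act : G →* (A ≃⋆ₐ[ℂ] A)
  continuous_act : ∀ s, Continuous (act s)
  continuous_orbit : ∀ a, Continuous fun s => act s a

lemma jointly_continuous {G X : Type*} [TopologicalSpace G] [LocallyCompactSpace G]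
    [NormedAddCommGroup X] [NormedSpace ℂ X] [CompleteSpace X] (V : G → X →L[ℂ] X)
    (hV : ∀ x, Continuous fun s => V s x) : Continuous fun p : G × X => V p.1 p.2 := by
  rw [continuous_iff_continuousAt]
  rintro ⟨r, x⟩
  obtain ⟨K, hK, hKn⟩ := exists_compact_mem_nhds r
  obtain ⟨C, hC⟩ := banach_steinhaus (g := fun s : K => V s) (by
    intro y
    obtain ⟨C, hC⟩ := hK.exists_bound_of_continuousOn (hV y).continuousOn
    exact ⟨C, fun s => hC s s.2⟩)
  have h1 : Tendsto (fun p : G × X => C * ‖p.2 - x‖ + ‖V p.1 x - V r x‖) (𝓝 (r, x)) (𝓝 0) := by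
    have : Continuous fun p : G × X => C * ‖p.2 - x‖ + ‖V p.1 x - V r x‖ := by
      have := (hV x).comp (continuous_fst (X := G) (Y := X))
      simp only [Function.comp_def] at this
      fun_prop
    simpa using this.tendsto (r, x)
  rw [ContinuousAt, tendsto_iff_norm_sub_tendsto_zero]
  refine squeeze_zero' (Eventually.of_forall fun _ => norm_nonneg _) ?_ h1
  have : ∀ᶠ p : G × X in 𝓝 (r, x), p.1 ∈ K := continuous_fst.continuousAt.eventually hKn
  filter_upwards [this] with p hp
  have e : V p.1 p.2 - V r x = V p.1 (p.2 - x) + (V p.1 x - V r x) := by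
    rw [map_sub]; abel
  rw [e]
  refine (norm_add_le _ _).trans (add_le_add ?_ le_rfl)
  exact ((V p.1).le_opNorm _).trans (mul_le_mul_of_nonneg_right (hC ⟨_, hp⟩) (norm_nonneg _))

section Convolution

variable {A : Type u} {G : Type w} [NonUnitalNormedRing A] [NormedSpace ℂ A]
  [IsScalarTower ℂ A A] [SMulCommClass ℂ A A] [StarRing A] [StarModule ℂ A] [ContinuousStar A]
  [CompleteSpace A] [Group G] [TopologicalSpace G] [IsTopologicalGroup G]
  [LocallyCompactSpace G] [T2Space G]

/-- `α_s` as a bounded operator. -/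
def InvolutiveSystem.actL (α : InvolutiveSystem A G) (s : G) : A →L[ℂ] A where
  toFun a := α.act s a
  map_add' := map_add (α.act s)
  map_smul' c a := map_smul (α.act s) c a
  cont := α.continuous_act s

lemma InvolutiveSystem.actL_apply (α : InvolutiveSystem A G) (s : G) (a : A) :
    α.actL s a = α.act s a := rfl

lemma InvolutiveSystem.act_mul (α : InvolutiveSystem A G) (s t : G) (a : A) :
    α.act (s * t) a = α.act s (α.act t a) := by
  rw [map_mul]; rfl

lemma InvolutiveSystem.act_one (α : InvolutiveSystem A G) (a : A) : α.act 1 a = a := by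
  rw [map_one]; rfl

lemma InvolutiveSystem.continuous_act₂ (α : InvolutiveSystem A G) :
    Continuous fun p : G × A => α.act p.1 p.2 :=
  jointly_continuous α.actL α.continuous_orbit

variable (α : InvolutiveSystem A G) [MeasurableSpace G] [BorelSpace G] (μ : Measure G)
  [μ.IsHaarMeasure]

/-- The twisted convolution `[f * g](s) = ∫ f(r) α_r(g(r⁻¹ s)) dr`. -/
def twistedConv (f g : C_c(G, A)) : C_c(G, A) where
  toFun s := ∫ r, f r * α.act r (g (r⁻¹ * s)) ∂μ
  continuous_toFun := by
    rw [← continuousOn_univ]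
    refine continuousOn_integral_of_compact_support (k := tsupport f) f.hasCompactSupport ?_ ?_
    · refine Continuous.continuousOn ?_
      exact (f.continuous.comp continuous_snd).mul (α.continuous_act₂.comp
        (continuous_snd.prodMk (g.continuous.comp (continuous_snd.inv.mul continuous_fst))))
    · intro s r _ hr
      rw [image_eq_zero_of_notMem_tsupport hr, zero_mul]
  hasCompactSupport' := by
    refine HasCompactSupport.intro (f.hasCompactSupport.isCompact.mul
      g.hasCompactSupport.isCompact) ?_
    intro s hs
    refine integral_eq_zero_of_ae (Eventually.of_forall fun r => ?_)
    by_contra h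
    apply hs
    have hf : f r ≠ 0 := fun h0 => h (by simp [h0])
    have hg : g (r⁻¹ * s) ≠ 0 := fun h0 => h (by simp [h0])
    exact ⟨r, subset_tsupport f hf, r⁻¹ * s, subset_tsupport g hg, by simp⟩

/-- The involution `f^*(s) = Δ(s⁻¹) α_s(f(s⁻¹)^*)`. -/
def twistedStar (f : C_c(G, A)) : C_c(G, A) where
  toFun s := (modularFn s⁻¹ : ℂ) • α.act s (star (f s⁻¹))
  continuous_toFun := by
    refine Continuous.smul (Complex.continuous_ofReal.comp (continuous_modularFn.comp
      continuous_inv)) (α.continuous_act₂.comp (continuous_id.prodMk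
        (f.continuous.comp continuous_inv).star))
  hasCompactSupport' := by
    refine HasCompactSupport.intro f.hasCompactSupport.isCompact.inv ?_
    intro s hs
    have : f s⁻¹ = 0 := by
      by_contra h
      exact hs (Set.mem_inv.2 (subset_tsupport f h))
    simp [this]

lemma twistedConv_apply (f g : C_c(G, A)) (s : G) :
    twistedConv α μ f g s = ∫ r, f r * α.act r (g (r⁻¹ * s)) ∂μ := rfl

lemma twistedStar_apply (f : C_c(G, A)) (s : G) :
    twistedStar α f s = (modularFn s⁻¹ : ℂ) • α.act s (star (f s⁻¹)) := rfl

section Core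

variable {X : Type*} [NormedAddCommGroup X] [NormedSpace ℂ X] [CompleteSpace X]
  (P : A →L[ℂ] X →L[ℂ] X) (V : G → X →L[ℂ] X)

lemma continuous_integrand (hV : Continuous fun p : G × X => V p.1 p.2)
    (f : C_c(G, A)) (x : G → X) (hx : Continuous x) :
    Continuous fun s => P (f s) (V s (x s)) :=
  (P.continuous.comp f.continuous).clm_apply (hV.comp (continuous_id.prodMk hx))

lemma hasCompactSupport_integrand (f : C_c(G, A)) (x : G → X) :
    HasCompactSupport fun s => P (f s) (V s (x s)) := by
  refine HasCompactSupport.intro f.hasCompactSupport.isCompact fun s hs => ?_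
  rw [image_eq_zero_of_notMem_tsupport hs, map_zero, zero_apply]

lemma integrable_integrand (hV : Continuous fun p : G × X => V p.1 p.2)
    (f : C_c(G, A)) (x : G → X) (hx : Continuous x) :
    Integrable (fun s => P (f s) (V s (x s))) μ :=
  (continuous_integrand P V hV f x hx).integrable_of_hasCompactSupport
    (hasCompactSupport_integrand P V f x)

lemma integrable_conv (f g : C_c(G, A)) (s : G) :
    Integrable (fun r => f r * α.act r (g (r⁻¹ * s))) μ := by
  refine Continuous.integrable_of_hasCompactSupport ?_ ?_
  · exact f.continuous.mul (α.continuous_act₂.comp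
        (continuous_id.prodMk (g.continuous.comp (continuous_inv.mul continuous_const))))
  · refine HasCompactSupport.intro f.hasCompactSupport.isCompact fun s hs => ?_
    rw [image_eq_zero_of_notMem_tsupport hs, zero_mul]

lemma integral_twistedConv (hP : ∀ a b x, P (a * b) x = P a (P b x))
    (hVm : ∀ s t x, V (s * t) x = V s (V t x))
    (hV : Continuous fun p : G × X => V p.1 p.2)
    (hc : ∀ s a x, P (α.act s a) (V s x) = V s (P a x))
    (f g : C_c(G, A)) (x : G → X) (hx : Continuous x) :
    ∫ s, P (twistedConv α μ f g s) (V s (x s⁻¹)) ∂μ =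
      ∫ r, P (f r) (V r (∫ t, P (g t) (V t (x (t⁻¹ * r⁻¹))) ∂μ)) ∂μ := by
  have h1 : ∀ s, P (twistedConv α μ f g s) (V s (x s⁻¹)) =
      ∫ r, P (f r) (P (α.act r (g (r⁻¹ * s))) (V s (x s⁻¹))) ∂μ := by
    intro s
    rw [twistedConv_apply]
    have := (P.flip (V s (x s⁻¹))).integral_comp_comm (integrable_conv α μ f g s)
    simp only [ContinuousLinearMap.flip_apply] at this
    rw [← this]
    simp_rw [hP]
  simp_rw [h1]
  rw [integral_integral_swap_of_hasCompactSupport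
    (f := fun s r => P (f r) (P (α.act r (g (r⁻¹ * s))) (V s (x s⁻¹))))]
  · congr 1
    ext r
    rw [← integral_mul_left_eq_self _ r]
    have h2 : ∀ s, P (f r) (P (α.act r (g (r⁻¹ * (r * s)))) (V (r * s) (x (r * s)⁻¹))) =
        ((P (f r)).comp (V r)) (P (g s) (V s (x (s⁻¹ * r⁻¹)))) := by
      intro s
      rw [inv_mul_cancel_left, hVm, hc, mul_inv_rev]
      rfl
    simp_rw [h2]
    rw [ContinuousLinearMap.integral_comp_comm]
    · rfl
    · exact integrable_integrand μ P V hV g (fun s => x (s⁻¹ * r⁻¹))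
        (hx.comp (continuous_inv.mul continuous_const))
  · refine Continuous.clm_apply (P.continuous.comp (f.continuous.comp continuous_snd)) ?_
    refine Continuous.clm_apply (P.continuous.comp (α.continuous_act₂.comp
      (continuous_snd.prodMk (g.continuous.comp (continuous_snd.inv.mul continuous_fst))))) ?_
    exact hV.comp (continuous_fst.prodMk (hx.comp continuous_fst.inv))
  · refine HasCompactSupport.intro ((f.hasCompactSupport.isCompact.mul
      g.hasCompactSupport.isCompact).prod f.hasCompactSupport.isCompact) ?_
    rintro ⟨s, r⟩ h
    by_contra h0
    have hf : f r ≠ 0 := fun h1 => h0 (by simp [h1])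
    have hg : g (r⁻¹ * s) ≠ 0 := fun h1 => h0 (by simp [h1])
    exact h ⟨⟨r, subset_tsupport f hf, r⁻¹ * s, subset_tsupport g hg, by simp⟩,
      subset_tsupport f hf⟩

end Core

lemma twistedConv_assoc (f g h : C_c(G, A)) :
    twistedConv α μ (twistedConv α μ f g) h = twistedConv α μ f (twistedConv α μ g h) := by
  ext s
  have := integral_twistedConv α μ (X := A) (ContinuousLinearMap.mul ℂ A) α.actL
    (by simp [mul_assoc]) (by intro s t x; exact α.act_mul s t x) α.continuous_act₂
    (by intro s a x; simp [InvolutiveSystem.actL_apply]) f g (fun u => h (u * s))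
    (h.continuous.comp (continuous_id.mul continuous_const))
  simpa [InvolutiveSystem.actL_apply, twistedConv_apply, mul_assoc] using this

lemma twistedStar_twistedStar (f : C_c(G, A)) : twistedStar α (twistedStar α f) = f := by
  ext s
  rw [twistedStar_apply, twistedStar_apply, inv_inv, star_smul, map_smul, smul_smul, ← map_star,
    star_star, ← α.act_mul, mul_inv_cancel, α.act_one]
  have := modularFn_inv_mul s
  rw [Complex.star_def, Complex.conj_ofReal, ← Complex.ofReal_mul, this]
  simp

lemma twistedStar_twistedConv (f g : C_c(G, A)) :
    twistedStar α (twistedConv α μ f g) =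
      twistedConv α μ (twistedStar α g) (twistedStar α f) := by
  ext s
  rw [twistedStar_apply, twistedConv_apply, twistedConv_apply]
  rw [← integral_mul_left_eq_self (fun r => twistedStar α g r *
    α.act r (twistedStar α f (r⁻¹ * s))) s]
  have h1 := (starL' ℝ (A := A)).toContinuousLinearMap.integral_comp_comm
    (integrable_conv α μ f g s⁻¹)
  simp only [ContinuousLinearEquiv.coe_coe, starL'_apply] at h1
  rw [← h1, ← InvolutiveSystem.actL_apply, ← ContinuousLinearMap.integral_comp_comm, ← integral_smul]
  · congr 1
    ext r
    rw [twistedStar_apply, twistedStar_apply, InvolutiveSystem.actL_apply, star_mul, map_mul,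
      map_smul, smul_mul_smul_comm, ← α.act_mul, ← map_star, ← α.act_mul, ← Complex.ofReal_mul,
      ← modularFn_mul]
    have hΔ : modularFn (r⁻¹ * s⁻¹ * r) = modularFn s⁻¹ := by
      rw [modularFn_mul, modularFn_mul, mul_right_comm, modularFn_inv_mul, one_mul]
    simp [hΔ]
  · exact (starL' ℝ (A := A)).toContinuousLinearMap.integrable_comp (integrable_conv α μ f g s⁻¹)

end Convolution

/-- A (bundled) complex Hilbert space, so that a class of Hilbert spaces is a
`Set HilbertSp`. -/
structure HilbertSp where
  carrier : Type v
  [normedAddCommGroup : NormedAddCommGroup carrier]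
  [innerProductSpace : InnerProductSpace ℂ carrier]
  [completeSpace : CompleteSpace carrier]

instance : CoeSort HilbertSp.{v} (Type v) := ⟨HilbertSp.carrier⟩
instance (H : HilbertSp.{v}) : NormedAddCommGroup H := H.normedAddCommGroup
instance (H : HilbertSp.{v}) : InnerProductSpace ℂ H := H.innerProductSpace
instance (H : HilbertSp.{v}) : CompleteSpace H := H.completeSpace

section CrossedProduct

variable {A : Type u} {G : Type w} [NonUnitalNormedRing A] [NormedSpace ℂ A]
  [IsScalarTower ℂ A A] [SMulCommClass ℂ A A] [StarRing A] [StarModule ℂ A] [ContinuousStar A]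
  [CompleteSpace A] [Group G] [TopologicalSpace G] [IsTopologicalGroup G]
  [LocallyCompactSpace G] [T2Space G]

/-- A continuous covariant representation `(π, U)` of `(A, G, α)` on the Hilbert space `H` such
that `π` is contractive and involutive and every `U_s` is unitary. -/
structure CovRep (α : InvolutiveSystem A G) (H : Type v) [NormedAddCommGroup H]
    [InnerProductSpace ℂ H] [CompleteSpace H] where
  π : A →⋆ₙₐ[ℂ] (H →L[ℂ] H)
  U : G →* unitary (H →L[ℂ] H)
  contractive : ∀ a, ‖π a‖ ≤ ‖a‖
  continuous_orbit : ∀ x, Continuous fun s => (U s : H →L[ℂ] H) x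
  covariant : ∀ s a, π (α.act s a) = (U s : H →L[ℂ] H) * π a * (U s⁻¹ : H →L[ℂ] H)

/-- A representation by bounded operators is non-degenerate if the span of all `π(b) x` is
dense. -/
def IsNondegenerate {B H : Type*} [NormedAddCommGroup H] [InnerProductSpace ℂ H]
    (π : B → (H →L[ℂ] H)) : Prop :=
  Dense (Submodule.span ℂ {y : H | ∃ b x, y = π b x} : Set H)

variable {α : InvolutiveSystem A G}

namespace CovRep

variable {H : Type v} [NormedAddCommGroup H] [InnerProductSpace ℂ H] [CompleteSpace H]
  (ρ : CovRep α H)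

/-- `π` as a bounded linear map. -/
def πL : A →L[ℂ] (H →L[ℂ] H) :=
  LinearMap.mkContinuous
    { toFun := ρ.π, map_add' := map_add ρ.π, map_smul' := map_smul ρ.π } 1
    (fun a => by simpa using ρ.contractive a)

lemma πL_apply (a : A) : ρ.πL a = ρ.π a := rfl

/-- `U_s` as a bounded operator. -/
def UL (s : G) : H →L[ℂ] H := (ρ.U s : H →L[ℂ] H)

lemma UL_mul (s t : G) (x : H) : ρ.UL (s * t) x = ρ.UL s (ρ.UL t x) := by
  simp [UL]

lemma UL_one (x : H) : ρ.UL 1 x = x := by simp [UL]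

lemma norm_UL (s : G) (x : H) : ‖ρ.UL s x‖ = ‖x‖ :=
  ContinuousLinearMap.norm_map_of_mem_unitary (ρ.U s).2 x

lemma star_UL (s : G) : star (ρ.UL s) = ρ.UL s⁻¹ := by
  rw [UL, UL, map_inv, ← Unitary.star_eq_inv]; rfl

lemma continuous_UL₂ : Continuous fun p : G × H => ρ.UL p.1 p.2 :=
  jointly_continuous ρ.UL ρ.continuous_orbit

lemma covariant_apply (s : G) (a : A) (x : H) :
    ρ.π (α.act s a) (ρ.UL s x) = ρ.UL s (ρ.π a x) := by
  rw [ρ.covariant]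
  change ρ.UL s (ρ.π a (ρ.UL s⁻¹ (ρ.UL s x))) = _
  rw [← ρ.UL_mul, inv_mul_cancel, UL_one]

variable [MeasurableSpace G] [BorelSpace G] (μ : Measure G) [μ.IsHaarMeasure]

lemma integrable (f : C_c(G, A)) (x : H) : Integrable (fun s => ρ.π (f s) (ρ.UL s x)) μ :=
  integrable_integrand μ ρ.πL ρ.UL ρ.continuous_UL₂ f (fun _ => x) continuous_const

/-- The operator `x ↦ ∫ π(f(s)) U_s x ds`. -/
def integral (f : C_c(G, A)) : H →L[ℂ] H :=
  LinearMap.mkContinuous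
    { toFun := fun x => ∫ s, ρ.π (f s) ((ρ.U s : H →L[ℂ] H) x) ∂μ
      map_add' := fun x y => by
        simp_rw [map_add]
        exact integral_add (ρ.integrable μ f x) (ρ.integrable μ f y)
      map_smul' := fun c x => by
        simp_rw [map_smul]
        exact integral_smul c _ } (∫ s, ‖f s‖ ∂μ)
    (fun x => by
      refine (norm_integral_le_integral_norm _).trans ?_
      rw [← integral_mul_const]
      have hf : Integrable (fun s => ‖f s‖) μ :=
        (f.continuous.integrable_of_hasCompactSupport f.hasCompactSupport).norm
      refine integral_mono (ρ.integrable μ f x).norm (hf.mul_const _) fun s => ?_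
      refine ((ρ.π (f s)).le_opNorm _).trans ?_
      refine mul_le_mul (ρ.contractive _) (ρ.norm_UL s x).le (norm_nonneg _) (norm_nonneg _))

lemma integral_apply (f : C_c(G, A)) (x : H) :
    ρ.integral μ f x = ∫ s, ρ.π (f s) ((ρ.U s : H →L[ℂ] H) x) ∂μ := rfl

lemma norm_integral_le (f : C_c(G, A)) : ‖ρ.integral μ f‖ ≤ ∫ s, ‖f s‖ ∂μ :=
  LinearMap.mkContinuous_norm_le _ (integral_nonneg fun _ => norm_nonneg _) _

lemma integral_add (f g : C_c(G, A)) :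
    ρ.integral μ (f + g) = ρ.integral μ f + ρ.integral μ g := by
  ext x
  simp only [integral_apply, CompactlySupportedContinuousMap.add_apply, map_add, add_apply]
  exact MeasureTheory.integral_add (ρ.integrable μ f x) (ρ.integrable μ g x)

lemma integral_smul (c : ℂ) (f : C_c(G, A)) :
    ρ.integral μ (c • f) = c • ρ.integral μ f := by
  ext x
  simp only [integral_apply, CompactlySupportedContinuousMap.smul_apply, map_smul, smul_apply]
  exact MeasureTheory.integral_smul c _

lemma integral_twistedConv (f g : C_c(G, A)) :
    ρ.integral μ (twistedConv α μ f g) = ρ.integral μ f * ρ.integral μ g := by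
  ext x
  exact BanachCrossed.integral_twistedConv α μ ρ.πL ρ.UL
    (fun a b y => by simp [πL_apply]) ρ.UL_mul ρ.continuous_UL₂ ρ.covariant_apply f g
    (fun _ => x) continuous_const

lemma integral_twistedStar (f : C_c(G, A)) :
    ρ.integral μ (twistedStar α f) = star (ρ.integral μ f) := by
  rw [ContinuousLinearMap.star_eq_adjoint, ContinuousLinearMap.eq_adjoint_iff]
  intro x y
  have hcont : Continuous fun s => ρ.UL s⁻¹ (ρ.π (star (f s)) x) :=
    ρ.continuous_UL₂.comp (continuous_inv.prodMk
      ((ρ.πL.continuous.comp f.continuous.star).clm_apply continuous_const))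
  have hcomp : HasCompactSupport fun s => ρ.UL s⁻¹ (ρ.π (star (f s)) x) :=
    HasCompactSupport.intro f.hasCompactSupport.isCompact fun s hs => by
      rw [image_eq_zero_of_notMem_tsupport hs]; simp
  have h1 : ρ.integral μ (twistedStar α f) x = ∫ s, ρ.UL s⁻¹ (ρ.π (star (f s)) x) ∂μ := by
    rw [← integral_modularFn_inv μ _ hcont hcomp, integral_apply]
    congr 1
    ext s
    rw [twistedStar_apply, map_smul, smul_apply, inv_inv]
    erw [ρ.covariant_apply]
    exact (RCLike.real_smul_eq_coe_smul (K := ℂ) _ _).symm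
  rw [h1]
  change _ = inner ℂ x (∫ s, ρ.π (f s) (ρ.UL s y) ∂μ)
  rw [← integral_inner (𝕜 := ℂ) (ρ.integrable μ f y)]
  rw [← inner_conj_symm, ← integral_inner (hcont.integrable_of_hasCompactSupport hcomp),
    ← integral_conj]
  congr 1
  ext s
  rw [inner_conj_symm]
  rw [← ρ.star_UL, map_star, ContinuousLinearMap.star_eq_adjoint,
    ContinuousLinearMap.star_eq_adjoint, ContinuousLinearMap.adjoint_inner_left,
    ContinuousLinearMap.adjoint_inner_left]

end CovRep

section Completion

open UniformSpace

variable (E : Type*) [NonUnitalSeminormedRing E] [NormedSpace ℂ E] [IsScalarTower ℂ E E]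
  [SMulCommClass ℂ E E] [StarRing E] [StarModule ℂ E] [NormedStarGroup E]

/-- The continuous extension of the multiplication to the completion. -/
@[reducible] def completionMul : Mul (Completion E) :=
  ⟨fun a b => (Completion.isDenseInducing_coe.prodMap Completion.isDenseInducing_coe).extend
    (fun p : E × E => ((p.1 * p.2 : E) : Completion E)) (a, b)⟩

/-- The continuous extension of the involution to the completion. -/
@[reducible] def completionStar : Star (Completion E) :=
  ⟨Completion.map star⟩

attribute [local instance] completionMul completionStar

lemma completion_coe_mul (a b : E) : ((a * b : E) : Completion E) = a * b :=
  ((Completion.isDenseInducing_coe.prodMap Completion.isDenseInducing_coe).extend_eq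
      ((Completion.continuous_coe E).comp (continuous_mul (M := E))) (a, b)).symm

lemma completion_continuousMul : ContinuousMul (Completion E) where
  continuous_mul := by
    let m := (AddMonoidHom.mul : E →+ E →+ E).compr₂ Completion.toCompl
    have : Continuous fun p : E × E => m p.1 p.2 :=
      (Completion.continuous_coe E).comp continuous_mul
    have di : IsDenseInducing (Completion.toCompl : E → Completion E) :=
      Completion.isDenseInducing_coe
    exact (di.extend_Z_bilin di this :)

lemma completion_coe_star (a : E) : ((star a : E) : Completion E) = star (a : Completion E) :=
  (Completion.map_coe (starₗᵢ ℂ (E := E)).isometry.uniformContinuous a).symm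

lemma completion_continuousStar : ContinuousStar (Completion E) :=
  ⟨Completion.continuous_map⟩

attribute [local instance] completion_continuousMul completion_continuousStar

/-- The completion as a normed ring. -/
@[reducible] def completionRing : NonUnitalNormedRing (Completion E) :=
  { (inferInstance : NormedAddCommGroup (Completion E)), completionMul E with
    zero_mul := fun a => Completion.induction_on a (isClosed_eq (by fun_prop) continuous_const)
        fun a => by rw [← Completion.coe_zero, ← completion_coe_mul, zero_mul]
    mul_zero := fun a => Completion.induction_on a (isClosed_eq (by fun_prop) continuous_const)
        fun a => by rw [← Completion.coe_zero, ← completion_coe_mul, mul_zero]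
    mul_assoc := fun a b c => Completion.induction_on₃ a b c
        (isClosed_eq (by fun_prop) (by fun_prop))
        fun a b c => by simp only [← completion_coe_mul, mul_assoc]
    left_distrib := fun a b c => Completion.induction_on₃ a b c
        (isClosed_eq (by fun_prop) (by fun_prop))
        fun a b c => by simp only [← completion_coe_mul, ← Completion.coe_add, mul_add]
    right_distrib := fun a b c => Completion.induction_on₃ a b c
        (isClosed_eq (by fun_prop) (by fun_prop))
        fun a b c => by simp only [← completion_coe_mul, ← Completion.coe_add, add_mul]
    norm_mul_le := fun a b => Completion.induction_on₂ a b
        (isClosed_le (by fun_prop) (by fun_prop))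
        fun a b => by
          simp only [← completion_coe_mul, Completion.norm_coe]
          exact norm_mul_le a b }

attribute [local instance] completionRing

lemma completion_isScalarTower : IsScalarTower ℂ (Completion E) (Completion E) where
  smul_assoc c a b := Completion.induction_on₂ a b
    (isClosed_eq ((continuous_fst.const_smul c).mul continuous_snd)
      ((continuous_fst.mul continuous_snd).const_smul c))
    fun a b => by
      change (c • (a : Completion E)) * (b : Completion E) =
        c • ((a : Completion E) * (b : Completion E))
      rw [← Completion.coe_smul, ← completion_coe_mul, ← completion_coe_mul,
        ← Completion.coe_smul, smul_mul_assoc]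

lemma completion_smulCommClass : SMulCommClass ℂ (Completion E) (Completion E) where
  smul_comm c a b := Completion.induction_on₂ a b
    (isClosed_eq ((continuous_fst.mul continuous_snd).const_smul c)
      (continuous_fst.mul (continuous_snd.const_smul c)))
    fun a b => by
      change c • ((a : Completion E) * (b : Completion E)) =
        (a : Completion E) * (c • (b : Completion E))
      rw [← Completion.coe_smul, ← completion_coe_mul, ← completion_coe_mul,
        ← Completion.coe_smul, mul_smul_comm]

/-- The completion as a star ring. -/
@[reducible] def completionStarRing : StarRing (Completion E) :=
  { completionStar E with
    star_involutive := fun a => Completion.induction_on a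
      (isClosed_eq (by fun_prop) continuous_id)
      fun a => by rw [← completion_coe_star, ← completion_coe_star, star_star]
    star_mul := fun a b => Completion.induction_on₂ a b
      (isClosed_eq (by fun_prop) (by fun_prop))
      fun a b => by simp only [← completion_coe_star, ← completion_coe_mul, star_mul]
    star_add := fun a b => Completion.induction_on₂ a b
      (isClosed_eq (by fun_prop) (by fun_prop))
      fun a b => by simp only [← completion_coe_star, ← Completion.coe_add, star_add] }

attribute [local instance] completionStarRing

lemma completion_starModule : StarModule ℂ (Completion E) where
  star_smul c a := Completion.induction_on a
    (isClosed_eq (continuous_id.const_smul c).star (continuous_id.star.const_smul (star c)))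
    fun a => by
      rw [← Completion.coe_smul, ← completion_coe_star, ← completion_coe_star,
        ← Completion.coe_smul, star_smul]

/-- The extension of a contractive involutive homomorphism into a complete star algebra. -/
def completionExtend {B : Type*} [NonUnitalNormedRing B] [NormedSpace ℂ B] [StarRing B]
    [ContinuousStar B] [CompleteSpace B] (f : E →⋆ₙₐ[ℂ] B) (hf : ∀ a, ‖f a‖ ≤ ‖a‖) :
    Completion E →⋆ₙₐ[ℂ] B :=
  have hu : UniformContinuous f :=
    (LipschitzWith.of_dist_le_mul (K := 1) fun a b => by
      rw [dist_eq_norm, dist_eq_norm, ← map_sub]; simpa using hf (a - b)).uniformContinuous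
  { toFun := Completion.extension f
    map_smul' := fun c a => Completion.induction_on a
      (isClosed_eq (Completion.continuous_extension.comp (continuous_const_smul c))
        (Completion.continuous_extension.const_smul c))
      fun a => by
        rw [MonoidHom.id_apply, ← Completion.coe_smul, Completion.extension_coe hu,
          Completion.extension_coe hu, map_smul]
    map_zero' := by rw [← Completion.coe_zero, Completion.extension_coe hu, map_zero]
    map_add' := fun a b => Completion.induction_on₂ a b
      (isClosed_eq (Completion.continuous_extension.comp continuous_add)
        ((Completion.continuous_extension.comp continuous_fst).add
          (Completion.continuous_extension.comp continuous_snd)))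
      fun a b => by
        rw [← Completion.coe_add]
        simp only [Completion.extension_coe hu, map_add]
    map_mul' := fun a b => Completion.induction_on₂ a b
      (isClosed_eq (Completion.continuous_extension.comp continuous_mul)
        ((Completion.continuous_extension.comp continuous_fst).mul
          (Completion.continuous_extension.comp continuous_snd)))
      fun a b => by
        rw [← completion_coe_mul]
        simp only [Completion.extension_coe hu, map_mul]
    map_star' := fun a => Completion.induction_on a
      (isClosed_eq (Completion.continuous_extension.comp continuous_star)
        (Completion.continuous_extension.star))
      fun a => by
        rw [← completion_coe_star]
        simp only [Completion.extension_coe hu, map_star] }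

lemma completionExtend_coe {B : Type*} [NonUnitalNormedRing B] [NormedSpace ℂ B] [StarRing B]
    [ContinuousStar B] [CompleteSpace B] (f : E →⋆ₙₐ[ℂ] B) (hf : ∀ a, ‖f a‖ ≤ ‖a‖) (a : E) :
    completionExtend E f hf (a : Completion E) = f a :=
  Completion.extension_coe (LipschitzWith.of_dist_le_mul (K := 1) fun a b => by
      rw [dist_eq_norm, dist_eq_norm, ← map_sub]; simpa using hf (a - b)).uniformContinuous a

end Completion

variable [MeasurableSpace G] [BorelSpace G]

/-- The space `C_c(G, A)`, to carry twisted convolution, the twisted involution and the seminorm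
`σ^R` of a class `R` of covariant representations. -/
def CcAlgebra (α : InvolutiveSystem A G) (_μ : Measure G)
    (_R : Set (Σ H : HilbertSp.{v}, CovRep α H)) : Type (max u w) := C_c(G, A)

variable (μ : Measure G) [μ.IsHaarMeasure] (R : Set (Σ H : HilbertSp.{v}, CovRep α H))

namespace CcAlgebra

instance : AddCommGroup (CcAlgebra α μ R) := inferInstanceAs (AddCommGroup C_c(G, A))
instance : Module ℂ (CcAlgebra α μ R) := inferInstanceAs (Module ℂ C_c(G, A))
instance : FunLike (CcAlgebra α μ R) G A := inferInstanceAs (FunLike C_c(G, A) G A)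

/-- Twisted convolution. -/
instance : Mul (CcAlgebra α μ R) := ⟨fun f g => twistedConv α μ f g⟩

/-- Twisted involution. -/
instance : Star (CcAlgebra α μ R) := ⟨fun f => twistedStar α f⟩

variable {μ R}

lemma ext {f g : CcAlgebra α μ R} (h : ∀ s, f s = g s) : f = g := DFunLike.ext f g h

lemma add_apply (f g : CcAlgebra α μ R) (s : G) : (f + g) s = f s + g s := rfl

lemma smul_apply (c : ℂ) (f : CcAlgebra α μ R) (s : G) : (c • f) s = c • f s := rfl

lemma mul_apply (f g : CcAlgebra α μ R) (s : G) :
    (f * g) s = ∫ r, f r * α.act r (g (r⁻¹ * s)) ∂μ := rfl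

lemma star_apply (f : CcAlgebra α μ R) (s : G) :
    (star f) s = (modularFn s⁻¹ : ℂ) • α.act s (star (f s⁻¹)) := rfl

lemma integrable_mul (f g : CcAlgebra α μ R) (s : G) :
    Integrable (fun r => f r * α.act r (g (r⁻¹ * s))) μ := integrable_conv α μ f g s

instance : NonUnitalRing (CcAlgebra α μ R) :=
  { (inferInstance : AddCommGroup (CcAlgebra α μ R)),
    (inferInstance : Mul (CcAlgebra α μ R)) with
    zero_mul := fun f => ext fun s => by
      rw [mul_apply]
      exact (integral_congr_ae (Eventually.of_forall fun r => zero_mul _)).trans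
        (integral_zero _ _)
    mul_zero := fun f => ext fun s => by
      rw [mul_apply]
      refine (integral_congr_ae (Eventually.of_forall fun r => ?_)).trans (integral_zero _ _)
      change f r * α.act r 0 = 0
      rw [map_zero, mul_zero]
    left_distrib := fun f g h => ext fun s => by
      simp only [add_apply, mul_apply, map_add, mul_add]
      exact integral_add (integrable_mul f g s) (integrable_mul f h s)
    right_distrib := fun f g h => ext fun s => by
      simp only [add_apply, mul_apply, add_mul]
      exact integral_add (integrable_mul f h s) (integrable_mul g h s)
    mul_assoc := fun f g h => twistedConv_assoc α μ f g h }

instance : StarRing (CcAlgebra α μ R) :=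
  { (inferInstance : Star (CcAlgebra α μ R)) with
    star_involutive := fun f => twistedStar_twistedStar α f
    star_mul := fun f g => twistedStar_twistedConv α μ f g
    star_add := fun f g => ext fun s => by
      simp only [add_apply, star_apply, star_add, map_add, smul_add] }

instance : IsScalarTower ℂ (CcAlgebra α μ R) (CcAlgebra α μ R) where
  smul_assoc c f g := ext fun s => by
    change ((c • f) * g) s = (c • (f * g)) s
    simp only [smul_apply, mul_apply, smul_mul_assoc]
    exact integral_smul c _

instance : SMulCommClass ℂ (CcAlgebra α μ R) (CcAlgebra α μ R) where
  smul_comm c f g := ext fun s => by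
    change (c • (f * g)) s = (f * (c • g)) s
    simp only [smul_apply, mul_apply, map_smul, mul_smul_comm]
    exact (integral_smul c _).symm

instance : StarModule ℂ (CcAlgebra α μ R) where
  star_smul c f := ext fun s => by
    simp only [smul_apply, star_apply, star_smul, map_smul]
    rw [smul_comm]

/-- The integrated form `π ⋊ U` on `C_c(G, A)`. -/
def intForm {H : Type*} [NormedAddCommGroup H] [InnerProductSpace ℂ H] [CompleteSpace H]
    (ρ : CovRep α H) : CcAlgebra α μ R →⋆ₙₐ[ℂ] (H →L[ℂ] H) where
  toFun f := ρ.integral μ f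
  map_smul' c f := ρ.integral_smul μ c f
  map_zero' := by
    have := ρ.integral_smul μ 0 (0 : C_c(G, A))
    rw [zero_smul, zero_smul] at this
    exact this
  map_add' f g := ρ.integral_add μ f g
  map_mul' f g := ρ.integral_twistedConv μ f g
  map_star' f := ρ.integral_twistedStar μ f

lemma intForm_apply {H : Type*} [NormedAddCommGroup H] [InnerProductSpace ℂ H] [CompleteSpace H]
    (ρ : CovRep α H) (f : CcAlgebra α μ R) (x : H) :
    intForm ρ f x = ∫ s, ρ.π (f s) ((ρ.U s : H →L[ℂ] H) x) ∂μ := rfl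

/-- `σ^R(f) = sup {‖(π ⋊ U)(f)‖ : (π, U) ∈ R}`. -/
def sigma (f : CcAlgebra α μ R) : ℝ := ⨆ p : R, ‖intForm p.1.2 f‖

lemma bddAbove_sigma (f : CcAlgebra α μ R) :
    BddAbove (Set.range fun p : R => ‖intForm p.1.2 f‖) := by
  refine ⟨∫ s, ‖f s‖ ∂μ, ?_⟩
  rintro _ ⟨p, rfl⟩
  exact p.1.2.norm_integral_le μ f

lemma norm_intForm_le_sigma (p : R) (f : CcAlgebra α μ R) : ‖intForm p.1.2 f‖ ≤ sigma f :=
  le_ciSup (bddAbove_sigma f) p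

lemma sigma_nonneg (f : CcAlgebra α μ R) : 0 ≤ sigma f :=
  Real.iSup_nonneg fun _ => norm_nonneg _

instance : SeminormedAddCommGroup (CcAlgebra α μ R) :=
  AddGroupSeminorm.toSeminormedAddCommGroup
    { toFun := sigma
      map_zero' := by simp [sigma]
      add_le' := fun f g => Real.iSup_le (fun p => by
        rw [map_add]
        exact (norm_add_le _ _).trans (add_le_add (norm_intForm_le_sigma p f)
          (norm_intForm_le_sigma p g))) (add_nonneg (sigma_nonneg f) (sigma_nonneg g))
      neg' := fun f => by simp [sigma, map_neg] }

lemma norm_def (f : CcAlgebra α μ R) : ‖f‖ = sigma f := rfl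

instance : NonUnitalSeminormedRing (CcAlgebra α μ R) :=
  { (inferInstance : SeminormedAddCommGroup (CcAlgebra α μ R)),
    (inferInstance : NonUnitalRing (CcAlgebra α μ R)) with
    norm_mul_le := fun f g => Real.iSup_le (fun p => by
      rw [map_mul]
      exact (norm_mul_le _ _).trans (mul_le_mul (norm_intForm_le_sigma p f)
        (norm_intForm_le_sigma p g) (norm_nonneg _) (sigma_nonneg f)))
      (mul_nonneg (sigma_nonneg f) (sigma_nonneg g)) }

instance : NormedSpace ℂ (CcAlgebra α μ R) where
  norm_smul_le c f := Real.iSup_le (fun p => by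
    rw [map_smul, norm_smul]
    exact mul_le_mul_of_nonneg_left (norm_intForm_le_sigma p f) (norm_nonneg _))
    (mul_nonneg (norm_nonneg _) (sigma_nonneg f))

instance : NormedStarGroup (CcAlgebra α μ R) where
  norm_star_le f := le_of_eq (by simp only [norm_def, sigma, map_star, norm_star])

end CcAlgebra

variable (α) in
/-- The crossed product `(A ⋊_α G)^R`: the (Hausdorff) completion of `C_c(G, A)` for the
seminorm `σ^R`, i.e. the completion of `C_c(G, A) / ker σ^R`. -/
def CrossedProduct : Type (max u w) := UniformSpace.Completion (CcAlgebra α μ R)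

namespace CrossedProduct

instance : NonUnitalNormedRing (CrossedProduct α μ R) := completionRing (CcAlgebra α μ R)
instance : NormedSpace ℂ (CrossedProduct α μ R) :=
  inferInstanceAs (NormedSpace ℂ (UniformSpace.Completion (CcAlgebra α μ R)))
instance : CompleteSpace (CrossedProduct α μ R) :=
  inferInstanceAs (CompleteSpace (UniformSpace.Completion (CcAlgebra α μ R)))
instance : StarRing (CrossedProduct α μ R) := completionStarRing (CcAlgebra α μ R)
instance : StarModule ℂ (CrossedProduct α μ R) := completion_starModule (CcAlgebra α μ R)
instance : IsScalarTower ℂ (CrossedProduct α μ R) (CrossedProduct α μ R) :=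
  completion_isScalarTower (CcAlgebra α μ R)
instance : SMulCommClass ℂ (CrossedProduct α μ R) (CrossedProduct α μ R) :=
  completion_smulCommClass (CcAlgebra α μ R)

variable {μ R}

/-- The canonical map `q^R : C_c(G, A) → (A ⋊_α G)^R`. -/
def q : CcAlgebra α μ R →⋆ₙₐ[ℂ] CrossedProduct α μ R where
  toFun f := (f : UniformSpace.Completion (CcAlgebra α μ R))
  map_smul' c f := UniformSpace.Completion.coe_smul c f
  map_zero' := UniformSpace.Completion.coe_zero
  map_add' f g := UniformSpace.Completion.coe_add f g
  map_mul' f g := completion_coe_mul _ f g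
  map_star' f := completion_coe_star _ f

lemma norm_q (f : CcAlgebra α μ R) : ‖q f‖ = CcAlgebra.sigma f :=
  UniformSpace.Completion.norm_coe f

lemma denseRange_q : DenseRange (q : CcAlgebra α μ R → CrossedProduct α μ R) :=
  UniformSpace.Completion.denseRange_coe

/-- The representation `(π ⋊ U)^R` of the crossed product, for `(π, U) ∈ R`. -/
def integratedForm (p : R) : CrossedProduct α μ R →⋆ₙₐ[ℂ] (p.1.1 →L[ℂ] p.1.1) :=
  completionExtend (CcAlgebra α μ R) (CcAlgebra.intForm p.1.2)
    (CcAlgebra.norm_intForm_le_sigma p)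

lemma integratedForm_q (p : R) (f : CcAlgebra α μ R) :
    integratedForm p (q f) = CcAlgebra.intForm p.1.2 f :=
  completionExtend_coe _ _ _ _

end CrossedProduct

end CrossedProduct

/-- The class of all non-degenerate continuous covariant representations `(π, U)` in spaces from
`𝓗`, with `π` contractive and involutive and `U` unitary. -/
def nondegCovReps {A : Type u} {G : Type w} [NonUnitalNormedRing A] [NormedSpace ℂ A]
    [StarRing A] [Group G] [TopologicalSpace G] (α : InvolutiveSystem A G)
    (𝓗 : Set HilbertSp.{v}) : Set (Σ H : HilbertSp.{v}, CovRep α H) :=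
  {p | p.1 ∈ 𝓗 ∧ IsNondegenerate p.2.π}

/-- The non-degenerate involutive representations of a star algebra in spaces from `𝓗`. -/
def nondegStarReps (B : Type*) [NonUnitalNonAssocSemiring B] [DistribMulAction ℂ B] [Star B]
    (𝓗 : Set HilbertSp.{v}) : Set (Σ H : HilbertSp.{v}, (B →⋆ₙₐ[ℂ] (H →L[ℂ] H))) :=
  {T | T.1 ∈ 𝓗 ∧ IsNondegenerate T.2}

/-- `A` has an `M`-bounded approximate left identity: a net in the closed `M`-ball, here encoded
by a filter, with `u a → a` for all `a`. -/
def HasBoundedLeftApproxIdentity (A : Type*) [NonUnitalNormedRing A] (M : ℝ) : Prop :=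
  ∃ l : Filter A, l.NeBot ∧ (∀ᶠ u in l, ‖u‖ ≤ M) ∧ ∀ a : A, Tendsto (fun u => u * a) l (𝓝 a)

end BanachCrossed

end

open BanachCrossed

/-!
Elements of `A` and of `G` act on `C_c(G, A)` by left multiplication and by twisted left
translation. Both actions are bounded for `σ^R`, and so they extend to left multipliers `i_A(a)`
and `i_G(s)` of the `C*`-algebra `(A ⋊_α G)^R`, which satisfy
`q(f) * c = ∫ i_A(f(s)) i_G(s) c ds`.

A non-degenerate representation `T` of a `C*`-algebra extends to left multipliers by
`T b x ↦ T (L b) x`; the contractive approximate unit shows that this operator is well defined and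
bounded. Extending `T` to `i_A` and `i_G` gives a covariant pair `(π, U)`, whose integrated form is
`T` by the displayed formula, and `π` is non-degenerate because a vector orthogonal to all
`π(a) x` is orthogonal to all `T(q(f)) x = ∫ π(f(s)) U_s x ds`. Conversely, when `T` is the
integrated form of `(π, U)`, the pair is recovered from `T` as this extension, which gives
injectivity and carries closed invariant subspaces and intertwining operators from `T` back to
`(π, U)`.
-/

noncomputable section

namespace BanachCrossed

section DenseSpan

variable {𝕜 E F : Type*} [NontriviallyNormedField 𝕜] [SeminormedAddCommGroup E]
  [NormedSpace 𝕜 E] [SeminormedAddCommGroup F] [NormedSpace 𝕜 F] {D : Set E} {M : ℝ}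

lemma tendsto_apply_of_dense_span {ι : Type*} {l : Filter ι} {S : ι → E →L[𝕜] F} {S₀ : E →L[𝕜] F}
    (hS : ∀ᶠ i in l, ‖S i‖ ≤ M) (hD : Dense (Submodule.span 𝕜 D : Set E))
    (h : ∀ x ∈ D, Tendsto (fun i => S i x) l (𝓝 (S₀ x))) (x : E) :
    Tendsto (fun i => S i x) l (𝓝 (S₀ x)) := by
  have hspan : ∀ y ∈ Submodule.span 𝕜 D, Tendsto (fun i => S i y) l (𝓝 (S₀ y)) := by
    intro y hy
    induction hy using Submodule.span_induction with
    | mem y hy => exact h y hy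
    | zero => simpa only [map_zero] using tendsto_const_nhds
    | add y z _ _ hy hz => simpa only [map_add] using hy.add hz
    | smul c y _ hy => simpa only [map_smul] using hy.const_smul c
  refine Metric.tendsto_nhds.2 fun ε hε => ?_
  have hC : 0 < |M| + ‖S₀‖ + 1 := by positivity
  obtain ⟨y, hy, hxy⟩ := Metric.mem_closure_iff.1 (hD x) (ε / 2 / (|M| + ‖S₀‖ + 1)) (by positivity)
  filter_upwards [hS, Metric.tendsto_nhds.1 (hspan y hy) (ε / 2) (half_pos hε)] with i hi hiy
  have hnorm : ‖S i - S₀‖ ≤ |M| + ‖S₀‖ + 1 := by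
    linarith [norm_sub_le (S i) S₀, le_abs_self M]
  rw [dist_eq_norm] at hxy hiy ⊢
  calc ‖S i x - S₀ x‖ = ‖(S i - S₀) (x - y) + (S i y - S₀ y)‖ := by
        rw [_root_.sub_apply, map_sub, map_sub]
        abel_nf
    _ ≤ (|M| + ‖S₀‖ + 1) * ‖x - y‖ + ‖S i y - S₀ y‖ :=
        norm_add_le_of_le ((S i - S₀).le_of_opNorm_le hnorm _) le_rfl
    _ < ε / 2 + ε / 2 := add_lt_add ((lt_div_iff₀' hC).1 hxy) hiy
    _ = ε := add_halves ε

lemma continuous_apply_of_dense_span {X : Type*} [TopologicalSpace X] {S : X → E →L[𝕜] F}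
    (hS : ∀ i, ‖S i‖ ≤ M) (hD : Dense (Submodule.span 𝕜 D : Set E))
    (h : ∀ x ∈ D, Continuous fun i => S i x) (x : E) : Continuous fun i => S i x :=
  continuous_iff_continuousAt.2 fun i =>
    tendsto_apply_of_dense_span (.of_forall hS) hD (fun y hy => (h y hy).tendsto i) x

end DenseSpan

section Integral

variable {X : Type*} [MeasurableSpace X] {μ : Measure X}

lemma integral_mem_of_isClosed {E : Type*} [NormedAddCommGroup E] [NormedSpace ℂ E]
    [CompleteSpace E] {K : Submodule ℂ E} (hK : IsClosed (K : Set E)) {f : X → E}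
    (hf : ∀ s, f s ∈ K) : ∫ s, f s ∂μ ∈ K := by
  by_cases hi : Integrable f μ
  · have hmk : ∀ s, K.mkQL (f s) = 0 := fun s => (Submodule.Quotient.mk_eq_zero K).2 (hf s)
    refine (Submodule.Quotient.mk_eq_zero K).1 (?_ : K.mkQL (∫ s, f s ∂μ) = 0)
    simp only [← K.mkQL.integral_comp_comm hi, hmk, integral_zero]
  · rw [integral_undef hi]
    exact K.zero_mem

variable [TopologicalSpace X] [LocallyCompactSpace X] [RegularSpace X] [BorelSpace X]
  [μ.IsOpenPosMeasure] [IsFiniteMeasureOnCompacts μ]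

lemma eq_zero_of_forall_integral_mul_eq_zero {h : X → ℂ} (hh : Continuous h)
    (hint : ∀ ψ : X → ℂ, Continuous ψ → HasCompactSupport ψ → ∫ s, ψ s * h s ∂μ = 0) (r : X) :
    h r = 0 := by
  obtain ⟨⟨ψ, hψ⟩, hψc, hψ0, hψr⟩ : ∃ ψ : C(X, ℝ), HasCompactSupport ψ ∧ 0 ≤ ψ ∧ ψ r ≠ 0 :=
    exists_continuous_nonneg_pos r
  have hzero := hint (fun s => ψ s * starRingEnd ℂ (h s)) (by fun_prop)
    (HasCompactSupport.mul_right (hψc.comp_left (g := Complex.ofReal) Complex.ofReal_zero))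
  by_contra hr
  have hpos : 0 < ∫ s, ψ s * ‖h s‖ ^ 2 ∂μ :=
    Continuous.integral_pos_of_hasCompactSupport_nonneg_nonzero (x := r) (by fun_prop)
      hψc.mul_right (fun s => mul_nonneg (hψ0 s) (sq_nonneg _))
      (mul_ne_zero hψr (pow_ne_zero _ (norm_ne_zero_iff.2 hr)))
  refine hpos.ne' (Complex.ofReal_injective ?_)
  rw [← integral_complex_ofReal, Complex.ofReal_zero, ← hzero]
  refine integral_congr_ae (.of_forall fun s => ?_)
  simp only [Complex.ofReal_mul, Complex.ofReal_pow, mul_assoc, Complex.conj_mul']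

end Integral

section Nondegenerate

variable {B H : Type*} [NormedAddCommGroup H] [InnerProductSpace ℂ H] {π : B → (H →L[ℂ] H)}

lemma IsNondegenerate.ext (hπ : IsNondegenerate π) {X : Type*} [NormedAddCommGroup X]
    [NormedSpace ℂ X] {S S' : H →L[ℂ] X} (h : ∀ b x, S (π b x) = S' (π b x)) : S = S' :=
  ContinuousLinearMap.ext_on hπ <| by
    rintro _ ⟨b, x, rfl⟩
    exact h b x

lemma isNondegenerate_iff_orthogonal [CompleteSpace H] :
    IsNondegenerate π ↔ ∀ y, (∀ b x, inner ℂ y (π b x) = 0) → y = 0 := by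
  rw [IsNondegenerate, Submodule.dense_iff_topologicalClosure_eq_top,
    Submodule.topologicalClosure_eq_top_iff, Submodule.eq_bot_iff]
  refine forall_congr' fun y => imp_congr_left ?_
  rw [← Submodule.span_singleton_le_iff_mem, ← Submodule.isOrtho_iff_le, Submodule.isOrtho_span]
  simp only [Set.mem_singleton_iff, Set.mem_ofPred_eq, forall_eq]
  exact ⟨fun h b x => h ⟨b, x, rfl⟩, by rintro h _ ⟨b, x, rfl⟩; exact h b x⟩

lemma IsNondegenerate.star_eq [CompleteSpace H] (hπ : IsNondegenerate π) {S S' : H →L[ℂ] H}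
    (h : ∀ b x d y, inner ℂ (π d y) (S (π b x)) = inner ℂ (S' (π d y)) (π b x)) : star S = S' :=
  hπ.ext fun d y => sub_eq_zero.1 <| isNondegenerate_iff_orthogonal.1 hπ _ fun b x => by
    rw [inner_sub_left, ContinuousLinearMap.star_eq_adjoint,
      ContinuousLinearMap.adjoint_inner_left, h, sub_self]

lemma IsNondegenerate.comp_eq_comp {H' : Type*} [NormedAddCommGroup H'] [InnerProductSpace ℂ H']
    {π' : B → (H' →L[ℂ] H')} {Φ : H →L[ℂ] H'} (hπ : IsNondegenerate π)
    (hΦ : ∀ b, (π' b).comp Φ = Φ.comp (π b)) {S : H →L[ℂ] H} {S' : H' →L[ℂ] H'} {L : B → B}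
    (hS : ∀ b, S * π b = π (L b)) (hS' : ∀ b, S' * π' b = π' (L b)) :
    S'.comp Φ = Φ.comp S :=
  hπ.ext fun b x => by
    have hΦ' : ∀ c, π' c (Φ x) = Φ (π c x) := fun c => DFunLike.congr_fun (hΦ c) x
    simp only [ContinuousLinearMap.comp_apply, ← mul_apply_eq_comp, hS, ← hΦ', hS']

end Nondegenerate

section Multipliers

open scoped TensorProduct CStarAlgebra

/-- Left multipliers (left centralizers) of a multiplicative structure. -/
def IsLeftMultiplier {B : Type*} [Mul B] (L : B → B) : Prop := ∀ c d, L (c * d) = L c * d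

variable {B H : Type*} [NonUnitalCStarAlgebra B] [NormedAddCommGroup H] [InnerProductSpace ℂ H]

variable (B) in
lemma exists_contractive_approxUnit : ∃ l : Filter B, l.NeBot ∧ (∀ᶠ e in l, ‖e‖ ≤ 1) ∧
    ∀ b, Tendsto (fun e => e * b) l (𝓝 b) := by
  let _ := CStarAlgebra.spectralOrder B
  have := CStarAlgebra.spectralOrderedRing B
  have h := CStarAlgebra.increasingApproximateUnit B
  exact ⟨_, h.neBot, h.eventually_norm, h.tendsto_mul_right⟩

/-- The linear map `B ⊗ H → H`, `b ⊗ x ↦ T b x`; its range is the span of the vectors `T b x`. -/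
def actionMap (T : B →ₗ[ℂ] H →L[ℂ] H) : B ⊗[ℂ] H →ₗ[ℂ] H :=
  TensorProduct.lift (ContinuousLinearMap.coeLM ℂ ∘ₗ T)

lemma denseRange_actionMap (T : B →ₗ[ℂ] H →L[ℂ] H) (hT : IsNondegenerate T) :
    DenseRange (actionMap T) := by
  refine hT.mono (Submodule.span_le (p := LinearMap.range (actionMap T)).2 ?_)
  rintro _ ⟨b, x, rfl⟩
  exact ⟨b ⊗ₜ x, rfl⟩

variable [CompleteSpace H] {T : B →⋆ₙₐ[ℂ] (H →L[ℂ] H)}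

variable (T) in
lemma continuous_rep_apply (x : H) : Continuous fun b => T b x :=
  (map_continuous T).clm_apply continuous_const

lemma IsLeftMultiplier.norm_actionMap_le {L : B →L[ℂ] B} (hL : IsLeftMultiplier L)
    (z : B ⊗[ℂ] H) :
    ‖actionMap ((T : B →ₗ[ℂ] H →L[ℂ] H) ∘ₗ L) z‖ ≤
      ‖L‖ * ‖actionMap (T : B →ₗ[ℂ] H →L[ℂ] H) z‖ := by
  obtain ⟨l, hl, hl1, hlb⟩ := exists_contractive_approxUnit B
  have hlim : Tendsto (fun e => T (L e) (actionMap (T : B →ₗ[ℂ] H →L[ℂ] H) z)) l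
      (𝓝 (actionMap ((T : B →ₗ[ℂ] H →L[ℂ] H) ∘ₗ L) z)) := by
    induction z using TensorProduct.induction_on with
    | zero => simpa only [map_zero] using tendsto_const_nhds
    | add z z' hz hz' => simpa only [map_add] using hz.add hz'
    | tmul b x =>
      have hcont : Continuous fun c => T (L c) x := (continuous_rep_apply T x).comp L.continuous
      refine ((hcont.tendsto b).comp (hlb b)).congr fun e => ?_
      rw [Function.comp_apply, hL, map_mul, mul_apply_eq_comp]
      rfl
  refine le_of_tendsto hlim.norm (hl1.mono fun e he => ?_)
  refine (T (L e)).le_of_opNorm_le ((NonUnitalStarAlgHom.norm_apply_le T _).trans ?_) _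
  exact (L.le_opNorm e).trans (mul_le_of_le_one_right (norm_nonneg _) he)

variable (T) in
/-- The extension of a representation `T` to a left multiplier `L`, i.e. the operator
`T b x ↦ T (L b) x`; it is `0` by convention when there is no such bounded operator. -/
def multiplierOp (L : B →L[ℂ] B) : H →L[ℂ] H :=
  (actionMap ((T : B →ₗ[ℂ] H →L[ℂ] H) ∘ₗ L)).extendOfNorm (actionMap (T : B →ₗ[ℂ] H →L[ℂ] H))

section

variable (hT : IsNondegenerate T) {L : B →L[ℂ] B} (hL : IsLeftMultiplier L)
include hT hL

lemma multiplierOp_apply (b : B) (x : H) : multiplierOp T L (T b x) = T (L b) x := by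
  have hdense := denseRange_actionMap (T : B →ₗ[ℂ] H →L[ℂ] H) hT
  unfold multiplierOp
  exact LinearMap.extendOfNorm_eq hdense ⟨_, hL.norm_actionMap_le⟩ (b ⊗ₜ x)

lemma norm_multiplierOp_le : ‖multiplierOp T L‖ ≤ ‖L‖ := by
  have hdense := denseRange_actionMap (T : B →ₗ[ℂ] H →L[ℂ] H) hT
  unfold multiplierOp
  exact LinearMap.opNorm_extendOfNorm_le hdense (norm_nonneg L) hL.norm_actionMap_le

end

variable (T) in
lemma inner_rep_rep (b c : B) (x y : H) :
    inner ℂ (T b x) (T c y) = inner ℂ x (T (star b * c) y) := by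
  rw [map_mul, map_star, mul_apply_eq_comp, ContinuousLinearMap.star_eq_adjoint,
    ContinuousLinearMap.adjoint_inner_right]

lemma star_multiplierOp (hT : IsNondegenerate T) {L L' : B →L[ℂ] B} (hL : IsLeftMultiplier L)
    (hL' : IsLeftMultiplier L') (h : ∀ c d, star (L c) * d = star c * L' d) :
    star (multiplierOp T L) = multiplierOp T L' :=
  hT.star_eq fun b x d y => by
    have hbd : star d * L b = star (L' d) * b := by
      simpa only [star_mul, star_star] using congr_arg star (h b d)
    rw [multiplierOp_apply hT hL, multiplierOp_apply hT hL', inner_rep_rep, inner_rep_rep, hbd]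

lemma tendsto_apply_approxUnit (hT : IsNondegenerate T) {l : Filter B}
    (hl : ∀ᶠ e in l, ‖e‖ ≤ 1) (hlb : ∀ b, Tendsto (fun e => e * b) l (𝓝 b)) (x : H) :
    Tendsto (fun e => T e x) l (𝓝 x) := by
  refine tendsto_apply_of_dense_span (S := fun e => T e) (S₀ := 1)
    (hl.mono fun e he => (NonUnitalStarAlgHom.norm_apply_le T e).trans he) hT ?_ x
  rintro _ ⟨b, y, rfl⟩
  refine (((continuous_rep_apply T y).tendsto b).comp (hlb b)).congr fun e => ?_
  simp only [Function.comp_apply, map_mul, mul_apply_eq_comp]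

lemma IsNondegenerate.apply_mem (hT : IsNondegenerate T) {K : Submodule ℂ H}
    (hK : IsClosed (K : Set H)) (hKT : ∀ b, ∀ x ∈ K, T b x ∈ K) {S : H →L[ℂ] H} {L : B → B}
    (hS : ∀ b, S * T b = T (L b)) {x : H} (hx : x ∈ K) : S x ∈ K := by
  obtain ⟨l, hl, hl1, hlb⟩ := exists_contractive_approxUnit B
  have hlim := (S.continuous.tendsto x).comp (tendsto_apply_approxUnit hT hl1 hlb x)
  refine hK.mem_of_tendsto hlim (.of_forall fun e => ?_)
  rw [Function.comp_apply, ← mul_apply_eq_comp, hS]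
  exact hKT _ x hx

end Multipliers

section CrossedProduct

variable {A : Type u} {G : Type w} [NonUnitalNormedRing A] [NormedSpace ℂ A] [StarRing A]
  [Group G] [TopologicalSpace G] {α : InvolutiveSystem A G}

namespace CovRep

variable {H : Type v} [NormedAddCommGroup H] [InnerProductSpace ℂ H] [CompleteSpace H]

lemma act_apply (ρ : CovRep α H) (s : G) (a : A) :
    ρ.π (α.act s a) = ρ.UL s * ρ.π a * ρ.UL s⁻¹ := ρ.covariant s a

@[ext]
lemma ext {ρ ρ' : CovRep α H} (hπ : ∀ a, ρ.π a = ρ'.π a) (hU : ∀ s, ρ.UL s = ρ'.UL s) :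
    ρ = ρ' := by
  obtain ⟨π, U, _, _, _⟩ := ρ
  obtain ⟨π', U', _, _, _⟩ := ρ'
  obtain rfl : π = π' := DFunLike.ext _ _ hπ
  obtain rfl : U = U' := MonoidHom.ext fun s => Subtype.ext (hU s)
  rfl

end CovRep

variable [MeasurableSpace G] {μ : Measure G} {R : Set (Σ H : HilbertSp.{v}, CovRep α H)}

namespace CcAlgebra

lemma continuous (f : CcAlgebra α μ R) : Continuous f :=
  map_continuous (show C_c(G, A) from f)

lemma hasCompactSupport (f : CcAlgebra α μ R) : HasCompactSupport f :=
  CompactlySupportedContinuousMap.hasCompactSupport (show C_c(G, A) from f)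

/-- A continuous compactly supported function as an element of the convolution algebra. -/
def mk (f : G → A) (hf : Continuous f) (hc : HasCompactSupport f) : CcAlgebra α μ R :=
  (⟨⟨f, hf⟩, hc⟩ : C_c(G, A))

lemma mk_apply (f : G → A) (hf : Continuous f) (hc : HasCompactSupport f) (s : G) :
    (mk f hf hc : CcAlgebra α μ R) s = f s := rfl

/-- The operator on `C_c(G, A)` which induces the left multiplier `i_A(a)` of the crossed
product. -/
def leftMul [SMulCommClass ℂ A A] (a : A) : CcAlgebra α μ R →ₗ[ℂ] CcAlgebra α μ R where
  toFun f := mk (fun s => a * f s) (continuous_const.mul f.continuous)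
    f.hasCompactSupport.mul_left
  map_add' f g := DFunLike.ext _ _ fun s => mul_add a (f s) (g s)
  map_smul' c f := DFunLike.ext _ _ fun s => mul_smul_comm c a (f s)

lemma leftMul_apply [SMulCommClass ℂ A A] (a : A) (f : CcAlgebra α μ R) (s : G) :
    leftMul a f s = a * f s := rfl

/-- The operator on `C_c(G, A)` which induces the left multiplier `i_G(s)` of the crossed
product. -/
def translate [IsTopologicalGroup G] (s : G) : CcAlgebra α μ R →ₗ[ℂ] CcAlgebra α μ R where
  toFun f := mk (fun t => α.act s (f (s⁻¹ * t)))
    ((α.continuous_act s).comp (f.continuous.comp (continuous_const.mul continuous_id)))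
    ((f.hasCompactSupport.comp_homeomorph (Homeomorph.mulLeft s⁻¹)).comp_left
      (g := α.act s) (map_zero _))
  map_add' f g := DFunLike.ext _ _ fun t => map_add (α.act s) (f (s⁻¹ * t)) (g (s⁻¹ * t))
  map_smul' c f := DFunLike.ext _ _ fun t => map_smul (α.act s) c (f (s⁻¹ * t))

lemma translate_apply [IsTopologicalGroup G] (s : G) (f : CcAlgebra α μ R) (t : G) :
    translate s f t = α.act s (f (s⁻¹ * t)) := rfl

variable [IsScalarTower ℂ A A] [SMulCommClass ℂ A A] [StarModule ℂ A] [ContinuousStar A]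
  [CompleteSpace A] [IsTopologicalGroup G] [LocallyCompactSpace G] [T2Space G] [BorelSpace G]
  [μ.IsHaarMeasure]

section IntForm

variable {H : Type v} [NormedAddCommGroup H] [InnerProductSpace ℂ H] [CompleteSpace H]
  (ρ : CovRep α H)

lemma intForm_apply_UL (f : CcAlgebra α μ R) (x : H) :
    intForm ρ f x = ∫ s, ρ.π (f s) (ρ.UL s x) ∂μ := rfl

lemma integrable_intForm (f : CcAlgebra α μ R) (x : H) :
    Integrable (fun s => ρ.π (f s) (ρ.UL s x)) μ := ρ.integrable μ f x

lemma intForm_leftMul (a : A) (f : CcAlgebra α μ R) :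
    intForm ρ (leftMul a f) = ρ.π a * intForm ρ f := by
  ext x
  rw [mul_apply_eq_comp, intForm_apply_UL, intForm_apply_UL,
    ← ContinuousLinearMap.integral_comp_comm _ (integrable_intForm ρ f x)]
  simp only [leftMul_apply, map_mul, mul_apply_eq_comp]

lemma intForm_translate (s : G) (f : CcAlgebra α μ R) :
    intForm ρ (translate s f) = ρ.UL s * intForm ρ f := by
  ext x
  rw [mul_apply_eq_comp, intForm_apply_UL, intForm_apply_UL,
    ← ContinuousLinearMap.integral_comp_comm _ (integrable_intForm ρ f x),
    ← integral_mul_left_eq_self _ s]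
  simp only [translate_apply, inv_mul_cancel_left, ρ.UL_mul, ρ.covariant_apply]

end IntForm

lemma sigma_le_integral_norm (f : CcAlgebra α μ R) : sigma f ≤ ∫ s, ‖f s‖ ∂μ :=
  Real.iSup_le (fun p => p.1.2.norm_integral_le μ f) (integral_nonneg fun _ => norm_nonneg _)

lemma sigma_le_mul {f g : CcAlgebra α μ R} {M : ℝ} (hM : 0 ≤ M)
    {S : ∀ p : R, p.1.1 →L[ℂ] p.1.1} (hS : ∀ p, ‖S p‖ ≤ M)
    (h : ∀ p : R, intForm p.1.2 g = S p * intForm p.1.2 f) : sigma g ≤ M * sigma f :=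
  Real.iSup_le (fun p => by
    rw [h]
    exact (norm_mul_le _ _).trans
      (mul_le_mul (hS p) (norm_intForm_le_sigma p f) (norm_nonneg _) hM))
    (mul_nonneg hM (sigma_nonneg f))

lemma sigma_leftMul_le (a : A) (f : CcAlgebra α μ R) : sigma (leftMul a f) ≤ ‖a‖ * sigma f :=
  sigma_le_mul (norm_nonneg a) (fun p => p.1.2.contractive a) fun p => intForm_leftMul p.1.2 a f

lemma sigma_translate_le (s : G) (f : CcAlgebra α μ R) :
    sigma (translate s f) ≤ 1 * sigma f :=
  sigma_le_mul zero_le_one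
    (fun p => ContinuousLinearMap.opNorm_le_bound _ zero_le_one fun x => by
      rw [p.1.2.norm_UL, one_mul])
    fun p => intForm_translate p.1.2 s f

lemma sigma_mul_self_le (f : CcAlgebra α μ R) : sigma f * sigma f ≤ sigma (star f * f) := by
  rw [← sq]
  refine (Real.le_sqrt (sigma_nonneg _) (sigma_nonneg _)).1 ?_
  refine Real.iSup_le (fun p => Real.le_sqrt_of_sq_le ?_) (Real.sqrt_nonneg _)
  rw [sq, ← CStarRing.norm_star_mul_self, ← map_star, ← map_mul]
  exact norm_intForm_le_sigma p _

lemma tendsto_integral_norm_translate_sub (f : CcAlgebra α μ R) (r : G) :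
    Tendsto (fun s => ∫ t, ‖(translate s f - translate r f) t‖ ∂μ) (𝓝 r) (𝓝 0) := by
  obtain ⟨K, hK, hKn⟩ := exists_compact_mem_nhds r
  have hcont : Continuous fun x : G × G => ‖translate x.1 f x.2 - translate r f x.2‖ :=
    ((α.continuous_act₂.comp (continuous_fst.prodMk
      (f.continuous.comp (continuous_fst.inv.mul continuous_snd)))).sub
        ((translate r f).continuous.comp continuous_snd)).norm
  have hzero : ∀ s ∈ K, ∀ t ∉ K * tsupport f, translate s f t = 0 := fun s hs t ht => by
    rw [translate_apply, image_eq_zero_of_notMem_tsupport (f := f), map_zero]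
    exact fun h => ht ⟨s, hs, _, h, mul_inv_cancel_left s t⟩
  have hint : ContinuousOn (fun s => ∫ t, ‖translate s f t - translate r f t‖ ∂μ) K :=
    continuousOn_integral_of_compact_support (hK.mul f.hasCompactSupport.isCompact)
      hcont.continuousOn fun s t hs ht => by
        rw [hzero s hs t ht, hzero r (mem_of_mem_nhds hKn) t ht, sub_zero, norm_zero]
  have hlim := (hint.continuousAt hKn).tendsto
  simp only [sub_self, norm_zero, integral_zero] at hlim
  exact hlim

end CcAlgebra

namespace CrossedProduct

variable [IsScalarTower ℂ A A] [SMulCommClass ℂ A A] [StarModule ℂ A] [ContinuousStar A]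
  [CompleteSpace A] [IsTopologicalGroup G] [LocallyCompactSpace G] [T2Space G] [BorelSpace G]
  [μ.IsHaarMeasure]

open CcAlgebra

open scoped CStarAlgebra

instance : CStarRing (CrossedProduct α μ R) where
  norm_mul_self_le c := by
    have : ContinuousStar (CrossedProduct α μ R) := completion_continuousStar (CcAlgebra α μ R)
    refine denseRange_q.induction_on (p := fun c => ‖c‖ * ‖c‖ ≤ ‖star c * c‖) c
      (isClosed_le (by fun_prop) (by fun_prop)) fun f => ?_
    rw [← map_star, ← map_mul, norm_q, norm_q]
    exact sigma_mul_self_le f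

instance : NonUnitalCStarAlgebra (CrossedProduct α μ R) where

lemma eq_zero_of_integratedForm {c : CrossedProduct α μ R}
    (h : ∀ p : R, integratedForm p c = 0) : c = 0 := by
  have hle : ‖c‖ ≤ ‖c - c‖ :=
    denseRange_q.induction_on (p := fun d => ‖d‖ ≤ ‖d - c‖) c
      (isClosed_le (by fun_prop) (by fun_prop)) fun f => by
        rw [norm_q]
        refine Real.iSup_le (fun p => ?_) (norm_nonneg _)
        rw [← integratedForm_q, ← sub_zero (integratedForm p (q f)), ← h p, ← map_sub]
        exact NonUnitalStarAlgHom.norm_apply_le _ _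
  rwa [sub_self, norm_zero, norm_le_zero_iff] at hle

lemma ext_integratedForm {c d : CrossedProduct α μ R}
    (h : ∀ p : R, integratedForm p c = integratedForm p d) : c = d :=
  sub_eq_zero.1 (eq_zero_of_integratedForm fun p => by rw [map_sub, h, sub_self])

section ExtendMap

/-- The extension to the crossed product of an operator on `C_c(G, A)`; it is `0` by convention
when the operator is not bounded for the seminorm `σ^R`. -/
def extendMap (m : CcAlgebra α μ R →ₗ[ℂ] CcAlgebra α μ R) :
    CrossedProduct α μ R →L[ℂ] CrossedProduct α μ R :=
  (LinearMapClass.linearMap q ∘ₗ m).extendOfNorm (LinearMapClass.linearMap q)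

variable {m : CcAlgebra α μ R →ₗ[ℂ] CcAlgebra α μ R} {M : ℝ}
  (hm : ∀ f, sigma (m f) ≤ M * sigma f)
include hm

lemma norm_q_comp_le (f : CcAlgebra α μ R) : ‖q (m f)‖ ≤ M * ‖q f‖ := by
  rw [norm_q, norm_q]
  exact hm f

lemma extendMap_q (f : CcAlgebra α μ R) : extendMap m (q f) = q (m f) := by
  unfold extendMap
  exact LinearMap.extendOfNorm_eq (e := LinearMapClass.linearMap q) denseRange_q
    ⟨M, norm_q_comp_le hm⟩ f

lemma norm_extendMap_le (hM : 0 ≤ M) : ‖extendMap m‖ ≤ M := by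
  unfold extendMap
  exact LinearMap.opNorm_extendOfNorm_le (e := LinearMapClass.linearMap q) denseRange_q hM
    (norm_q_comp_le hm)

lemma integratedForm_extendMap (p : R) {S : p.1.1 →L[ℂ] p.1.1}
    (h : ∀ f, intForm p.1.2 (m f) = S * intForm p.1.2 f) (c : CrossedProduct α μ R) :
    integratedForm p (extendMap m c) = S * integratedForm p c := by
  have hc : Continuous (integratedForm (μ := μ) p) := map_continuous _
  refine denseRange_q.induction_on
    (p := fun c => integratedForm p (extendMap m c) = S * integratedForm p c) c
    (isClosed_eq (by fun_prop) (by fun_prop)) fun f => ?_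
  rw [extendMap_q hm, integratedForm_q, integratedForm_q, h]

end ExtendMap

variable (α μ R) in
/-- The canonical image `i_G(s)` of `s ∈ G` in the left multipliers of the crossed product. -/
def iG (s : G) : CrossedProduct α μ R →L[ℂ] CrossedProduct α μ R := extendMap (translate s)

lemma iG_q (s : G) (f : CcAlgebra α μ R) : iG α μ R s (q f) = q (translate s f) :=
  extendMap_q (sigma_translate_le s) f

lemma norm_iG_le (s : G) : ‖iG α μ R s‖ ≤ 1 :=
  norm_extendMap_le (sigma_translate_le s) zero_le_one

lemma integratedForm_iG (p : R) (s : G) (c : CrossedProduct α μ R) :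
    integratedForm p (iG α μ R s c) = p.1.2.UL s * integratedForm p c :=
  integratedForm_extendMap (sigma_translate_le s) p (intForm_translate p.1.2 s) c

lemma isLeftMultiplier_iG (s : G) : IsLeftMultiplier (iG α μ R s) := fun c d =>
  ext_integratedForm fun p => by simp only [integratedForm_iG, map_mul, mul_assoc]

lemma iG_one (c : CrossedProduct α μ R) : iG α μ R 1 c = c :=
  ext_integratedForm fun p => by
    rw [integratedForm_iG]
    exact ContinuousLinearMap.ext fun x => p.1.2.UL_one _

lemma iG_mul (s t : G) (c : CrossedProduct α μ R) :
    iG α μ R (s * t) c = iG α μ R s (iG α μ R t c) :=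
  ext_integratedForm fun p => by
    simp only [integratedForm_iG]
    exact ContinuousLinearMap.ext fun x => p.1.2.UL_mul s t _

lemma star_iG_mul (s : G) (c d : CrossedProduct α μ R) :
    star (iG α μ R s c) * d = star c * iG α μ R s⁻¹ d :=
  ext_integratedForm fun p => by
    simp only [integratedForm_iG, map_mul, map_star, star_mul, mul_assoc, p.1.2.star_UL]

lemma continuous_iG_q (f : CcAlgebra α μ R) : Continuous fun s => iG α μ R s (q f) :=
  continuous_iff_continuousAt.2 fun r => tendsto_iff_norm_sub_tendsto_zero.2 <|
    squeeze_zero (fun _ => norm_nonneg _) (fun s => by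
      dsimp only
      rw [iG_q, iG_q, ← map_sub, norm_q]
      exact sigma_le_integral_norm _) (tendsto_integral_norm_translate_sub f r)

lemma continuous_iG (c : CrossedProduct α μ R) : Continuous fun s => iG α μ R s c := by
  refine continuous_apply_of_dense_span norm_iG_le (denseRange_q.mono Submodule.subset_span) ?_ c
  rintro _ ⟨f, rfl⟩
  exact continuous_iG_q f

lemma integratedForm_extendMap_leftMul (p : R) (a : A) (c : CrossedProduct α μ R) :
    integratedForm p (extendMap (leftMul a) c) = p.1.2.π a * integratedForm p c :=
  integratedForm_extendMap (sigma_leftMul_le a) p (intForm_leftMul p.1.2 a) c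

variable (α μ R) in
/-- The canonical map `i_A` from `A` to the left multipliers of the crossed product. -/
def iA : A →L[ℂ] CrossedProduct α μ R →L[ℂ] CrossedProduct α μ R :=
  LinearMap.mkContinuous
    { toFun := fun a => extendMap (leftMul a)
      map_add' := fun a b => ContinuousLinearMap.ext fun c => ext_integratedForm fun p => by
        simp only [integratedForm_extendMap_leftMul, map_add, _root_.add_apply, add_mul]
      map_smul' := fun z a => ContinuousLinearMap.ext fun c => ext_integratedForm fun p => by
        simp only [integratedForm_extendMap_leftMul, map_smul, _root_.smul_apply,
          smul_mul_assoc, RingHom.id_apply] } 1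
    fun a => by
      rw [one_mul]
      exact norm_extendMap_le (sigma_leftMul_le a) (norm_nonneg a)

lemma norm_iA_le (a : A) : ‖iA α μ R a‖ ≤ ‖a‖ :=
  norm_extendMap_le (sigma_leftMul_le a) (norm_nonneg a)

lemma integratedForm_iA (p : R) (a : A) (c : CrossedProduct α μ R) :
    integratedForm p (iA α μ R a c) = p.1.2.π a * integratedForm p c :=
  integratedForm_extendMap_leftMul p a c

lemma isLeftMultiplier_iA (a : A) : IsLeftMultiplier (iA α μ R a) := fun c d =>
  ext_integratedForm fun p => by simp only [integratedForm_iA, map_mul, mul_assoc]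

lemma iA_mul (a b : A) (c : CrossedProduct α μ R) :
    iA α μ R (a * b) c = iA α μ R a (iA α μ R b c) :=
  ext_integratedForm fun p => by simp only [integratedForm_iA, map_mul, mul_assoc]

lemma star_iA_mul (a : A) (c d : CrossedProduct α μ R) :
    star (iA α μ R a c) * d = star c * iA α μ R (star a) d :=
  ext_integratedForm fun p => by
    simp only [integratedForm_iA, map_mul, map_star, star_mul, mul_assoc]

lemma iA_act (s : G) (a : A) (c : CrossedProduct α μ R) :
    iA α μ R (α.act s a) c = iG α μ R s (iA α μ R a (iG α μ R s⁻¹ c)) :=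
  ext_integratedForm fun p => by
    simp only [integratedForm_iA, integratedForm_iG, p.1.2.act_apply, mul_assoc]

lemma integrable_iA_iG (f : CcAlgebra α μ R) (c : CrossedProduct α μ R) :
    Integrable (fun s => iA α μ R (f s) (iG α μ R s c)) μ :=
  Continuous.integrable_of_hasCompactSupport
    (((iA α μ R).continuous.comp f.continuous).clm_apply (continuous_iG c))
    (.intro f.hasCompactSupport.isCompact fun s hs => by
      rw [image_eq_zero_of_notMem_tsupport hs, map_zero, zero_apply])

lemma apply_integral_iA_iG {H : Type*} [NormedAddCommGroup H] [InnerProductSpace ℂ H]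
    [CompleteSpace H] (T : CrossedProduct α μ R →⋆ₙₐ[ℂ] (H →L[ℂ] H)) (f : CcAlgebra α μ R)
    (c : CrossedProduct α μ R) (x : H) :
    T (∫ s, iA α μ R (f s) (iG α μ R s c) ∂μ) x =
      ∫ s, T (iA α μ R (f s) (iG α μ R s c)) x ∂μ := by
  let ev : CrossedProduct α μ R →L[ℂ] H :=
    ⟨LinearMap.applyₗ x ∘ₗ ContinuousLinearMap.coeLM ℂ ∘ₗ
      (T : CrossedProduct α μ R →ₗ[ℂ] H →L[ℂ] H), continuous_rep_apply T x⟩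
  exact (ev.integral_comp_comm (integrable_iA_iG f c)).symm

lemma q_mul (f : CcAlgebra α μ R) (c : CrossedProduct α μ R) :
    q f * c = ∫ s, iA α μ R (f s) (iG α μ R s c) ∂μ :=
  ext_integratedForm fun p => ContinuousLinearMap.ext fun x => by
    rw [apply_integral_iA_iG, map_mul, mul_apply_eq_comp, integratedForm_q, intForm_apply_UL]
    simp only [integratedForm_iA, integratedForm_iG, mul_apply_eq_comp]

section Integration

lemma isNondegenerate_integratedForm (p : R) (hp : IsNondegenerate p.1.2.π) :
    IsNondegenerate (integratedForm (μ := μ) p) := by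
  rw [isNondegenerate_iff_orthogonal] at hp ⊢
  refine fun y hy => hp y fun a x => ?_
  have hcont : Continuous fun s => inner ℂ y (p.1.2.π a (p.1.2.UL s x)) :=
    continuous_const.inner ((p.1.2.π a).continuous.comp (p.1.2.continuous_orbit x))
  have hint : ∀ ψ : G → ℂ, Continuous ψ → HasCompactSupport ψ →
      ∫ s, ψ s * inner ℂ y (p.1.2.π a (p.1.2.UL s x)) ∂μ = 0 := by
    intro ψ hψ hψc
    have hψa := hy (q (mk (fun s => ψ s • a) (by fun_prop) hψc.smul_right)) x
    rw [integratedForm_q, intForm_apply_UL, ← integral_inner (integrable_intForm _ _ _)] at hψa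
    simpa only [mk_apply, map_smul, _root_.smul_apply, inner_smul_right] using hψa
  simpa only [p.1.2.UL_one] using eq_zero_of_forall_integral_mul_eq_zero hcont hint 1

lemma invariant_iff (p : R) (hp : IsNondegenerate p.1.2.π) {K : Submodule ℂ p.1.1}
    (hK : IsClosed (K : Set p.1.1)) :
    ((∀ a, ∀ x ∈ K, p.1.2.π a x ∈ K) ∧ ∀ s, ∀ x ∈ K, p.1.2.UL s x ∈ K) ↔
      ∀ c : CrossedProduct α μ R, ∀ x ∈ K, integratedForm p c x ∈ K := by
  constructor
  · rintro ⟨hπ, hU⟩ c x hx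
    refine denseRange_q.induction_on (p := fun c => integratedForm p c x ∈ K) c
      (hK.preimage (continuous_rep_apply (integratedForm p) x)) fun f => ?_
    rw [integratedForm_q, intForm_apply_UL]
    exact integral_mem_of_isClosed hK fun s => hπ _ _ (hU _ _ hx)
  · intro h
    have hT := isNondegenerate_integratedForm (μ := μ) p hp
    exact ⟨fun a x => hT.apply_mem hK h fun c => (integratedForm_iA p a c).symm,
      fun s x => hT.apply_mem hK h fun c => (integratedForm_iG p s c).symm⟩

lemma intertwines_iff (p p' : R) (hp : IsNondegenerate p.1.2.π) (Φ : p.1.1 →L[ℂ] p'.1.1) :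
    ((∀ a, (p'.1.2.π a).comp Φ = Φ.comp (p.1.2.π a)) ∧
        ∀ s, (p'.1.2.UL s).comp Φ = Φ.comp (p.1.2.UL s)) ↔
      ∀ c : CrossedProduct α μ R,
        (integratedForm p' c).comp Φ = Φ.comp (integratedForm p c) := by
  constructor
  · rintro ⟨hπ, hU⟩ c
    refine denseRange_q.induction_on
      (p := fun c => (integratedForm p' c).comp Φ = Φ.comp (integratedForm p c)) c
      (isClosed_eq ((map_continuous (integratedForm p')).clm_comp continuous_const)
        (continuous_const.clm_comp (map_continuous (integratedForm p)))) fun f => ?_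
    ext x
    have hπ' : ∀ a y, p'.1.2.π a (Φ y) = Φ (p.1.2.π a y) := fun a => DFunLike.congr_fun (hπ a)
    have hU' : ∀ s y, p'.1.2.UL s (Φ y) = Φ (p.1.2.UL s y) := fun s => DFunLike.congr_fun (hU s)
    simp only [ContinuousLinearMap.comp_apply, integratedForm_q, intForm_apply_UL, hU', hπ']
    exact Φ.integral_comp_comm (integrable_intForm _ _ _)
  · intro h
    have hT := isNondegenerate_integratedForm (μ := μ) p hp
    exact ⟨fun a => hT.comp_eq_comp h (fun c => (integratedForm_iA p a c).symm)
        fun c => (integratedForm_iA p' a c).symm,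
      fun s => hT.comp_eq_comp h (fun c => (integratedForm_iG p s c).symm)
        fun c => (integratedForm_iG p' s c).symm⟩

lemma integratedForm_injective (hR : ∀ p ∈ R, IsNondegenerate p.2.π) :
    Function.Injective fun p : R => (⟨p.1.1, integratedForm p⟩ :
      Σ H : HilbertSp.{v}, (CrossedProduct α μ R →⋆ₙₐ[ℂ] (H →L[ℂ] H))) := by
  rintro ⟨⟨H, ρ⟩, hρ⟩ ⟨⟨H', ρ'⟩, hρ'⟩ h
  obtain ⟨rfl, h⟩ := Sigma.mk.inj_iff.1 h
  have heq : ∀ c : CrossedProduct α μ R,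
      integratedForm ⟨⟨H, ρ⟩, hρ⟩ c = integratedForm ⟨⟨H, ρ'⟩, hρ'⟩ c :=
    DFunLike.congr_fun (eq_of_heq h)
  have hT := isNondegenerate_integratedForm (μ := μ) ⟨⟨H, ρ⟩, hρ⟩ (hR _ hρ)
  have hρρ' : ρ = ρ' := by
    refine CovRep.ext (fun a => hT.ext fun c x => ?_) fun s => hT.ext fun c x => ?_
    · rw [← mul_apply_eq_comp, ← mul_apply_eq_comp, ← integratedForm_iA ⟨⟨H, ρ⟩, hρ⟩, heq, heq,
        ← integratedForm_iA ⟨⟨H, ρ'⟩, hρ'⟩]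
    · rw [← mul_apply_eq_comp, ← mul_apply_eq_comp, ← integratedForm_iG ⟨⟨H, ρ⟩, hρ⟩, heq, heq,
        ← integratedForm_iG ⟨⟨H, ρ'⟩, hρ'⟩]
  subst hρρ'
  rfl

end Integration

section Disintegration

variable {H : Type v} [NormedAddCommGroup H] [InnerProductSpace ℂ H] [CompleteSpace H]
  {T : CrossedProduct α μ R →⋆ₙₐ[ℂ] (H →L[ℂ] H)}

variable (T) in
/-- The operator `π(a)` determined by a non-degenerate representation of the crossed product. -/
def repA (a : A) : H →L[ℂ] H := multiplierOp T (iA α μ R a)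

variable (T) in
/-- The operator `U_s` determined by a non-degenerate representation of the crossed product. -/
def repG (s : G) : H →L[ℂ] H := multiplierOp T (iG α μ R s)

variable (hT : IsNondegenerate T)
include hT

lemma repA_apply (a : A) (c : CrossedProduct α μ R) (x : H) :
    repA T a (T c x) = T (iA α μ R a c) x := multiplierOp_apply hT (isLeftMultiplier_iA a) c x

lemma repG_apply (s : G) (c : CrossedProduct α μ R) (x : H) :
    repG T s (T c x) = T (iG α μ R s c) x := multiplierOp_apply hT (isLeftMultiplier_iG s) c x

lemma norm_repA_le (a : A) : ‖repA T a‖ ≤ ‖a‖ :=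
  (norm_multiplierOp_le hT (isLeftMultiplier_iA a)).trans (norm_iA_le a)

lemma norm_repG_le (s : G) : ‖repG T s‖ ≤ 1 :=
  (norm_multiplierOp_le hT (isLeftMultiplier_iG s)).trans (norm_iG_le s)

lemma star_repA (a : A) : star (repA T a) = repA T (star a) :=
  star_multiplierOp hT (isLeftMultiplier_iA a) (isLeftMultiplier_iA _) (star_iA_mul a)

lemma star_repG (s : G) : star (repG T s) = repG T s⁻¹ :=
  star_multiplierOp hT (isLeftMultiplier_iG s) (isLeftMultiplier_iG _) (star_iG_mul s)

lemma repG_one : repG T 1 = 1 :=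
  hT.ext fun c x => by rw [repG_apply hT, iG_one, one_apply_eq_self]

lemma repG_mul (s t : G) : repG T (s * t) = repG T s * repG T t :=
  hT.ext fun c x => by
    simp only [mul_apply_eq_comp, repG_apply hT, iG_mul]

lemma repG_mem_unitary (s : G) : repG T s ∈ unitary (H →L[ℂ] H) := by
  rw [Unitary.mem_iff, star_repG hT, ← repG_mul hT, ← repG_mul hT, inv_mul_cancel,
    mul_inv_cancel, repG_one hT]
  exact ⟨rfl, rfl⟩

lemma continuous_repG (x : H) : Continuous fun s => repG T s x := by
  refine continuous_apply_of_dense_span (norm_repG_le hT) hT ?_ x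
  rintro _ ⟨c, y, rfl⟩
  simp only [repG_apply hT]
  exact (continuous_rep_apply T y).comp (continuous_iG c)

lemma repA_act (s : G) (a : A) : repA T (α.act s a) = repG T s * repA T a * repG T s⁻¹ :=
  hT.ext fun c x => by
    simp only [mul_apply_eq_comp, repG_apply hT, repA_apply hT, iA_act]

/-- The covariant representation determined by a non-degenerate representation of the crossed
product. -/
def covRepOf : CovRep α H where
  π :=
    { toFun := repA T
      map_smul' := fun z a => hT.ext fun c x => by
        simp only [repA_apply hT, map_smul, _root_.smul_apply, MonoidHom.id_apply]
      map_zero' := hT.ext fun c x => by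
        simp only [repA_apply hT, map_zero, _root_.zero_apply]
      map_add' := fun a b => hT.ext fun c x => by
        simp only [repA_apply hT, map_add, _root_.add_apply]
      map_mul' := fun a b => hT.ext fun c x => by
        simp only [repA_apply hT, mul_apply_eq_comp, iA_mul]
      map_star' := fun a => (star_repA hT a).symm }
  U :=
    { toFun := fun s => ⟨repG T s, repG_mem_unitary hT s⟩
      map_one' := Subtype.ext (repG_one hT)
      map_mul' := fun s t => Subtype.ext (repG_mul hT s t) }
  contractive := norm_repA_le hT
  continuous_orbit := continuous_repG hT
  covariant := repA_act hT

lemma covRepOf_π_UL (a : A) (s : G) (c : CrossedProduct α μ R) (x : H) :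
    (covRepOf hT).π a ((covRepOf hT).UL s (T c x)) = T (iA α μ R a (iG α μ R s c)) x :=
  (congr_arg (repA T a) (repG_apply hT s c x)).trans (repA_apply hT a _ x)

lemma intForm_covRepOf (f : CcAlgebra α μ R) : intForm (covRepOf hT) f = T (q f) :=
  hT.ext fun c x => by
    rw [intForm_apply_UL, ← mul_apply_eq_comp, ← map_mul, q_mul, apply_integral_iA_iG]
    simp only [covRepOf_π_UL]

lemma isNondegenerate_covRepOf : IsNondegenerate (covRepOf hT).π :=
  isNondegenerate_iff_orthogonal.2 fun y hy => isNondegenerate_iff_orthogonal.1 hT y fun c x => by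
    refine denseRange_q.induction_on (p := fun c => inner ℂ y (T c x) = 0) c
      (isClosed_eq (continuous_const.inner (continuous_rep_apply T x)) continuous_const)
      fun f => ?_
    rw [← intForm_covRepOf hT, intForm_apply_UL, ← integral_inner (integrable_intForm _ _ _)]
    simp only [hy, integral_zero]

end Disintegration

lemma integratedForm_covRepOf {H : HilbertSp.{v}}
    {T : CrossedProduct α μ R →⋆ₙₐ[ℂ] (H →L[ℂ] H)} (hT : IsNondegenerate T)
    (hmem : ⟨H, covRepOf hT⟩ ∈ R) : integratedForm ⟨⟨H, covRepOf hT⟩, hmem⟩ = T :=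
  DFunLike.ext' <| denseRange_q.equalizer (map_continuous _) (map_continuous T) <|
    funext fun f => (integratedForm_q _ f).trans (intForm_covRepOf hT f)

end CrossedProduct

end CrossedProduct

end BanachCrossed

end

theorem theoremt_general {A : Type u} {G : Type w}
    [NonUnitalNormedRing A] [NormedSpace ℂ A] [IsScalarTower ℂ A A] [SMulCommClass ℂ A A]
    [CompleteSpace A] [StarRing A] [StarModule ℂ A] [ContinuousStar A]
    [Group G] [TopologicalSpace G] [IsTopologicalGroup G] [LocallyCompactSpace G] [T2Space G]
    [MeasurableSpace G] [BorelSpace G] (μ : Measure G) [μ.IsHaarMeasure]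
    (α : InvolutiveSystem A G)
    (𝓗 : Set HilbertSp.{v}) :
    (CompleteSpace (CrossedProduct α μ (nondegCovReps α 𝓗)) ∧
      CStarRing (CrossedProduct α μ (nondegCovReps α 𝓗))) ∧
    (Function.Injective (fun p : nondegCovReps α 𝓗 =>
        (⟨p.1.1, CrossedProduct.integratedForm p⟩ : Σ H : HilbertSp.{v},
          (CrossedProduct α μ (nondegCovReps α 𝓗) →⋆ₙₐ[ℂ] (H →L[ℂ] H)))) ∧
      Set.range (fun p : nondegCovReps α 𝓗 =>
        (⟨p.1.1, CrossedProduct.integratedForm p⟩ : Σ H : HilbertSp.{v},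
          (CrossedProduct α μ (nondegCovReps α 𝓗) →⋆ₙₐ[ℂ] (H →L[ℂ] H)))) =
        nondegStarReps (CrossedProduct α μ (nondegCovReps α 𝓗)) 𝓗) ∧
    (∀ (p : nondegCovReps α 𝓗) (K : Submodule ℂ p.1.1), IsClosed (K : Set p.1.1) →
      (((∀ a, ∀ x ∈ K, p.1.2.π a x ∈ K) ∧
          ∀ s, ∀ x ∈ K, (p.1.2.U s : p.1.1 →L[ℂ] p.1.1) x ∈ K) ↔
        ∀ c : CrossedProduct α μ (nondegCovReps α 𝓗), ∀ x ∈ K,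
          CrossedProduct.integratedForm p c x ∈ K)) ∧
    (∀ (p p' : nondegCovReps α 𝓗) (Φ : p.1.1 →L[ℂ] p'.1.1),
      ((∀ a, (p'.1.2.π a).comp Φ = Φ.comp (p.1.2.π a)) ∧
          ∀ s, (p'.1.2.U s : p'.1.1 →L[ℂ] p'.1.1).comp Φ =
            Φ.comp (p.1.2.U s : p.1.1 →L[ℂ] p.1.1)) ↔
        ∀ c : CrossedProduct α μ (nondegCovReps α 𝓗),
          (CrossedProduct.integratedForm p' c).comp Φ =
            Φ.comp (CrossedProduct.integratedForm p c)) := by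
  refine ⟨⟨inferInstance, inferInstance⟩,
    ⟨CrossedProduct.integratedForm_injective fun _ hp => hp.2, ?_⟩,
    fun p K hK => CrossedProduct.invariant_iff p p.2.2 hK,
    fun p p' Φ => CrossedProduct.intertwines_iff p p' p.2.2 Φ⟩
  refine Set.Subset.antisymm ?_ ?_
  · rintro _ ⟨p, rfl⟩
    exact ⟨p.2.1, CrossedProduct.isNondegenerate_integratedForm p p.2.2⟩
  · rintro ⟨H, T⟩ ⟨hH, hT⟩
    have hmem : ⟨H, CrossedProduct.covRepOf hT⟩ ∈ nondegCovReps α 𝓗 :=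
      ⟨hH, CrossedProduct.isNondegenerate_covRepOf hT⟩
    exact ⟨⟨_, hmem⟩, congrArg (Sigma.mk H) (CrossedProduct.integratedForm_covRepOf hT hmem)⟩

theorem theoremt {A : Type u} {G : Type w}
    -- `A` is a complex Banach algebra, possibly without unit, with a bounded involution
    [NonUnitalNormedRing A] [NormedSpace ℂ A] [IsScalarTower ℂ A A] [SMulCommClass ℂ A A]
    [CompleteSpace A] [StarRing A] [StarModule ℂ A] [ContinuousStar A]
    -- `G` is a locally compact Hausdorff group with left Haar measure `μ`
    [Group G] [TopologicalSpace G] [IsTopologicalGroup G] [LocallyCompactSpace G] [T2Space G]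
    [MeasurableSpace G] [BorelSpace G] (μ : Measure G) [μ.IsHaarMeasure]
    (α : InvolutiveSystem A G)
    (hA : ∀ ε : ℝ, 0 < ε → HasBoundedLeftApproxIdentity A (1 + ε))
    (𝓗 : Set HilbertSp.{v})
    (hR : (nondegCovReps α 𝓗).Nonempty) :
    -- the crossed product is a C*-algebra
    (CompleteSpace (CrossedProduct α μ (nondegCovReps α 𝓗)) ∧
      CStarRing (CrossedProduct α μ (nondegCovReps α 𝓗))) ∧
    -- integration is injective, with range the non-degenerate involutive representations
    (Function.Injective (fun p : nondegCovReps α 𝓗 =>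
        (⟨p.1.1, CrossedProduct.integratedForm p⟩ : Σ H : HilbertSp.{v},
          (CrossedProduct α μ (nondegCovReps α 𝓗) →⋆ₙₐ[ℂ] (H →L[ℂ] H)))) ∧
      Set.range (fun p : nondegCovReps α 𝓗 =>
        (⟨p.1.1, CrossedProduct.integratedForm p⟩ : Σ H : HilbertSp.{v},
          (CrossedProduct α μ (nondegCovReps α 𝓗) →⋆ₙₐ[ℂ] (H →L[ℂ] H)))) =
        nondegStarReps (CrossedProduct α μ (nondegCovReps α 𝓗)) 𝓗) ∧
    -- it preserves the closed invariant subspaces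
    (∀ (p : nondegCovReps α 𝓗) (K : Submodule ℂ p.1.1), IsClosed (K : Set p.1.1) →
      (((∀ a, ∀ x ∈ K, p.1.2.π a x ∈ K) ∧
          ∀ s, ∀ x ∈ K, (p.1.2.U s : p.1.1 →L[ℂ] p.1.1) x ∈ K) ↔
        ∀ c : CrossedProduct α μ (nondegCovReps α 𝓗), ∀ x ∈ K,
          CrossedProduct.integratedForm p c x ∈ K)) ∧
    -- it preserves the bounded intertwining operators
    (∀ (p p' : nondegCovReps α 𝓗) (Φ : p.1.1 →L[ℂ] p'.1.1),
      ((∀ a, (p'.1.2.π a).comp Φ = Φ.comp (p.1.2.π a)) ∧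
          ∀ s, (p'.1.2.U s : p'.1.1 →L[ℂ] p'.1.1).comp Φ =
            Φ.comp (p.1.2.U s : p.1.1 →L[ℂ] p.1.1)) ↔
        ∀ c : CrossedProduct α μ (nondegCovReps α 𝓗),
          (CrossedProduct.integratedForm p' c).comp Φ =
            Φ.comp (CrossedProduct.integratedForm p c)) :=
  theoremt_general μ α 𝓗
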